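/- Let $\bar\alpha,\bar\beta\in\mathbb R$, and let $\tilde\alpha_j,\tilde\beta_j:\mathbb R\to\mathbb R$ $(j\in\mathbb Z)$ be continuous $2\pi$-periodic functions such that, for some $\rho_0>0$, $\cosh(2\rho_0 j)^{1/2}\tilde\alpha_j(t)$ and $\cosh(2\rho_0 j)^{1/2}\tilde\beta_j(t)$ are bounded uniformly in $j\in\mathbb Z$ and $t\in\mathbb R$. Put $\alpha_j=\bar\alpha+\tilde\alpha_j$ and $\beta_j=\bar\beta+\tilde\beta_j$. On $\ell^2(\mathbb Z)=\ell^2(\mathbb Z,\mathbb C)$ let $(\nabla_0 v)_j=v_j-v_{j-1}$ and $H(t)=\nabla_0^*\alpha(t)\nabla_0+\beta(t)$, where $\alpha(t)$ and $\beta(t)$ act by pointwise multiplication. Let $\Phi(t)$ be the time-$t$ map, starting at time $0$, of the linear equation $\frac{d}{dt}(v,\nu)=(\nu,-H(t)v)$ on $\ell^2(\mathbb Z)^2$. For $n\ge 1$ let $\mathbb Z_n=\{j\in\mathbb Z:-n<j\le n\}$. Let $H_n(t)$ be the self-adjoint operator on $\ell^2(\mathbb Z)$ which, on sequences supported in $\mathbb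 Z_n$, is the operator of the periodic chain of length $2n$ with quadratic form $$\langle v,H_n(t)v\rangle=\alpha_{1-n}(t)|v_{1-n}-v_n|^2+\sum_{j=2-n}^{n}\alpha_j(t)|v_j-v_{j-1}|^2+\sum_{j=1-n}^{n}\beta_j(t)|v_j|^2,$$ and which acts as multiplication by $\bar\beta$ on sequences vanishing on $\mathbb Z_n$. Let $\Phi_n(t)$ be the time-$t$ map of $\frac{d}{dt}(v,\nu)=(\nu,-H_n(t)v)$ on $\ell^2(\mathbb Z)^2$, and let $\Sigma_n$ be the spectrum of $\Phi_n(2\pi):\ell^2(\mathbb Z)^2\to\ell^2(\mathbb Z)^2$. Let $h_0(\varphi)=2\bar\alpha(1-\cos\varphi)+\bar\beta$ and $$\Sigma_0^e=\{e^{2\pi z}: z\in\mathbb C,\ -z^2\in h_0(\mathbb R)\}.$$ Theorem. Let $\lambda\in\mathbb C\setminus\Sigma_0^e$. Then $\lambda$ is an eigenvalue of $\Phi(2\pi):\ell^2(\mathbb Z)^2\to\ell^2(\mathbb Z)^2$ if and only if there exists a sequence of points $\lambda_n\in\Sigma_n$ $(n\ge1)$ that accumulates at $\lambda$ as $n\to\infty$,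 that is, for every neighbourhood $U$ of $\lambda$ one has $\lambda_n\in U$ for infinitely many $n$. -/

import Mathlib

open scoped lp ENNReal

namespace LatticeFlow

/-! ### Time maps of linear non-autonomous equations -/

section TimeMap

/-- The terms of the iterated-integral series, used only to construct time maps. -/
noncomputable def dyson {R : Type*} [NormedRing R] [NormedAlgebra ℝ R] (A : ℝ → R) : ℕ → ℝ → R
  | 0 => fun _ => 1
  | k + 1 => fun t => ∫ s in (0 : ℝ)..t, A s * dyson A k s

theorem dyson_continuous {R : Type*} [NormedRing R] [NormedAlgebra ℝ R]
    {A : ℝ → R} (hA : Continuous A) (k : ℕ) : Continuous (dyson A k) := by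
  induction k with
  | zero => exact continuous_const
  | succ k ih =>
    exact intervalIntegral.continuous_primitive (μ := MeasureTheory.volume)
      (fun a b => (hA.mul ih).intervalIntegrable a b) 0

theorem dyson_hasDerivAt {R : Type*} [NormedRing R] [NormedAlgebra ℝ R] [CompleteSpace R]
    {A : ℝ → R} (hA : Continuous A) (k : ℕ) (t : ℝ) :
    HasDerivAt (dyson A (k + 1)) (A t * dyson A k t) t := by
  have hc := hA.mul (dyson_continuous hA k)
  exact intervalIntegral.integral_hasDerivAt_right (hc.intervalIntegrable 0 t)
    hc.stronglyMeasurable.stronglyMeasurableAtFilter hc.continuousAt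

theorem dyson_bound {R : Type*} [NormedRing R] [NormedAlgebra ℝ R]
    {A : ℝ → R} {M T : ℝ} (hM : 0 ≤ M)
    (hA : ∀ t, |t| ≤ T → ‖A t‖ ≤ M) (k : ℕ) :
    ∀ t, |t| ≤ T → ‖dyson A k t‖ ≤ ‖(1 : R)‖ * (M * |t|) ^ k / k.factorial := by
  induction k with
  | zero => intro t _; simp [dyson]
  | succ k ih =>
    intro t ht
    have h1 : dyson A (k + 1) t = t • ∫ u in (0 : ℝ)..1, A (t * u) * dyson A k (t * u) := by
      have := intervalIntegral.smul_integral_comp_mul_left (a := 0) (b := 1)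
        (fun s => A s * dyson A k s) t
      simpa [dyson] using this.symm
    have h2 : ‖∫ u in (0 : ℝ)..1, A (t * u) * dyson A k (t * u)‖ ≤
        ∫ u in (0 : ℝ)..1, (M * (‖(1 : R)‖ * (M * |t|) ^ k / k.factorial)) * u ^ k := by
      apply intervalIntegral.norm_integral_le_of_norm_le zero_le_one
      · refine Filter.Eventually.of_forall fun u hu => ?_
        have hu0 : 0 ≤ u := hu.1.le
        have htu : |t * u| ≤ |t| := by
          rw [abs_mul, abs_of_nonneg hu0]
          exact mul_le_of_le_one_right (abs_nonneg t) hu.2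
        calc ‖A (t * u) * dyson A k (t * u)‖
            ≤ ‖A (t * u)‖ * ‖dyson A k (t * u)‖ := norm_mul_le _ _
          _ ≤ M * (‖(1 : R)‖ * (M * |t * u|) ^ k / k.factorial) := by
              gcongr
              · exact hA _ (htu.trans ht)
              · exact ih _ (htu.trans ht)
          _ = (M * (‖(1 : R)‖ * (M * |t|) ^ k / k.factorial)) * u ^ k := by
              rw [abs_mul, abs_of_nonneg hu0]; ring
      · exact (by fun_prop : Continuous fun u : ℝ =>
          (M * (‖(1 : R)‖ * (M * |t|) ^ k / k.factorial)) * u ^ k).intervalIntegrable 0 1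
    rw [h1, norm_smul, Real.norm_eq_abs]
    refine (mul_le_mul_of_nonneg_left h2 (abs_nonneg t)).trans (le_of_eq ?_)
    rw [intervalIntegral.integral_const_mul, integral_pow, Nat.factorial_succ]
    push_cast
    have : (k : ℝ) + 1 ≠ 0 := by positivity
    have : (k.factorial : ℝ) ≠ 0 := by positivity
    field_simp
    ring

/-- A linear equation `Φ' = A(t) Φ` with continuous coefficient in a Banach algebra has a global
solution with `Φ(0) = 1`. -/
theorem exists_fundamental {R : Type*} [NormedRing R] [NormedAlgebra ℝ R] [CompleteSpace R]
    {A : ℝ → R} (hA : Continuous A) :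
    ∃ Φ : ℝ → R, Φ 0 = 1 ∧ ∀ t, HasDerivAt Φ (A t * Φ t) t := by
  refine ⟨fun t => 1 + ∑' k, dyson A (k + 1) t, by simp [dyson], fun t => ?_⟩
  set T : ℝ := |t| + 1 with hT
  have hT0 : 0 < T := by positivity
  obtain ⟨M, hM⟩ := (isCompact_Icc (a := -T) (b := T)).exists_bound_of_continuousOn
    hA.continuousOn
  have hM0 : 0 ≤ M := (norm_nonneg _).trans (hM 0 ⟨(neg_lt_zero.mpr hT0).le, hT0.le⟩)
  have hA' : ∀ s, |s| ≤ T → ‖A s‖ ≤ M := fun s hs => hM s (abs_le.mp hs)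
  have hb : ∀ k, ∀ s, |s| ≤ T → ‖dyson A k s‖ ≤ ‖(1 : R)‖ * ((M * T) ^ k / k.factorial) := by
    intro k s hs
    refine (dyson_bound hM0 hA' k s hs).trans ?_
    rw [mul_div_assoc]
    gcongr
  have hsum : Summable fun k : ℕ => ‖(1 : R)‖ * ((M * T) ^ k / k.factorial) :=
    (Real.summable_pow_div_factorial (M * T)).mul_left _
  have htT : |t| ≤ T := by simp [hT]
  have hD : Summable fun k => dyson A k t := .of_norm_bounded hsum fun k => hb k t htT
  have hmem : ∀ {s : ℝ}, s ∈ Set.Ioo (-T) T → |s| ≤ T := fun hs => abs_le.mpr ⟨hs.1.le, hs.2.le⟩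
  have key := hasDerivAt_tsum_of_isPreconnected (y := t) (y₀ := 0) (hsum.mul_left M)
    (isOpen_Ioo (a := -T) (b := T)) isPreconnected_Ioo
    (fun k s _ => dyson_hasDerivAt hA k s)
    (fun k s hs => (norm_mul_le _ _).trans
      (mul_le_mul (hA' s (hmem hs)) (hb k s (hmem hs)) (norm_nonneg _) hM0))
    ⟨neg_lt_zero.mpr hT0, hT0⟩ (by simp [dyson, summable_zero])
    ⟨by linarith [neg_abs_le t], by linarith [le_abs_self t]⟩
  have h0 : A t * (1 + ∑' k, dyson A (k + 1) t) = ∑' k, A t * dyson A k t := by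
    rw [hD.tsum_mul_left, hD.tsum_eq_zero_add]; rfl
  rw [h0]
  exact key.const_add 1

variable {E : Type*} [NormedAddCommGroup E] [NormedSpace ℂ E] [CompleteSpace E]

/-- The family of time-`t` maps `v(0) ↦ v(t)` of the linear equation `v'(t) = A(t) v(t)`, with
`A` a norm-continuous curve of bounded operators: the operator-valued solution of
`Φ'(t) = A(t) Φ(t)`, `Φ(0) = I`. It is unique, see `timeMap_eq` below. -/
noncomputable def timeMap (A : ℝ → E →L[ℂ] E) (hA : Continuous A) : ℝ → E →L[ℂ] E :=
  (exists_fundamental hA).choose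

theorem timeMap_zero (A : ℝ → E →L[ℂ] E) (hA : Continuous A) : timeMap A hA 0 = 1 :=
  (exists_fundamental hA).choose_spec.1

theorem timeMap_hasDerivAt (A : ℝ → E →L[ℂ] E) (hA : Continuous A) (t : ℝ) :
    HasDerivAt (timeMap A hA) (A t ∘L timeMap A hA t) t :=
  (exists_fundamental hA).choose_spec.2 t

theorem timeMap_apply_hasDerivAt (A : ℝ → E →L[ℂ] E) (hA : Continuous A) (v : E) (t : ℝ) :
    HasDerivAt (fun s => timeMap A hA s v) (A t (timeMap A hA t v)) t := by
  let ev : (E →L[ℂ] E) →L[ℝ] E := (ContinuousLinearMap.apply ℂ E v).restrictScalars ℝ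
  exact ev.hasFDerivAt.comp_hasDerivAt t (timeMap_hasDerivAt A hA t)

/-- Every solution `u` of `u'(t) = A(t) u(t)` on the line satisfies `u(t) = Φ(t) u(0)`. -/
theorem timeMap_eq (A : ℝ → E →L[ℂ] E) (hA : Continuous A) (u : ℝ → E)
    (hu : ∀ t, HasDerivAt u (A t (u t)) t) (t : ℝ) : u t = timeMap A hA t (u 0) := by
  set T : ℝ := |t| + 1 with hT
  have hT0 : 0 < T := by positivity
  obtain ⟨M, hM⟩ := (isCompact_Icc (a := -T) (b := T)).exists_bound_of_continuousOn
    hA.continuousOn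
  have hlip : ∀ s ∈ Set.Ioo (-T) T,
      LipschitzOnWith M.toNNReal (fun x => A s x) Set.univ := by
    intro s hs
    refine ((A s).lipschitz.weaken ?_).lipschitzOnWith
    rw [← NNReal.coe_le_coe]
    exact (hM s ⟨hs.1.le, hs.2.le⟩).trans (Real.le_coe_toNNReal M)
  have := ODE_solution_unique_of_mem_Ioo (v := fun s x => A s x) (s := fun _ => Set.univ)
    (t₀ := 0) (f := u) (g := fun s => timeMap A hA s (u 0)) hlip
    ⟨neg_lt_zero.mpr hT0, hT0⟩
    (fun s _ => ⟨hu s, trivial⟩)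
    (fun s _ => ⟨timeMap_apply_hasDerivAt A hA (u 0) s, trivial⟩)
    (by simp [timeMap_zero])
  exact this ⟨by linarith [neg_abs_le t], by linarith [le_abs_self t]⟩

end TimeMap

/-! ### Operators on `ℓ²(ℤ)` -/

/-- The operator of pointwise multiplication by a bounded sequence, linear and continuous in that
sequence. -/
noncomputable def mulOp : ℓ^∞(ℤ, ℂ) →L[ℂ] ℓ²(ℤ, ℂ) →L[ℂ] ℓ²(ℤ, ℂ) :=
  lp.holderL 2 (K := 1) (fun _ => ContinuousLinearMap.mul ℂ ℂ) (fun _ => by simp)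

theorem mulOp_apply (a : ℓ^∞(ℤ, ℂ)) (v : ℓ²(ℤ, ℂ)) (j : ℤ) : mulOp a v j = a j * v j := rfl

/-- The operator `(v_j)_j ↦ (v_{σ(j)})_j` defined by a permutation `σ` of `ℤ`. -/
noncomputable def permOp (σ : Equiv.Perm ℤ) : ℓ²(ℤ, ℂ) →L[ℂ] ℓ²(ℤ, ℂ) :=
  LinearMap.mkContinuous
    { toFun := fun v => ⟨fun j => v (σ j), by
        have h := (lp.memℓp v).summable (by norm_num)
        exact memℓp_gen (h.comp_injective σ.injective)⟩
      map_add' := fun _ _ => rfl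
      map_smul' := fun _ _ => rfl } 1
    fun v => by
      refine lp.norm_le_of_tsum_le (by norm_num) (by positivity) ?_
      · simp only [one_mul]
        rw [lp.norm_rpow_eq_tsum (by norm_num)]
        exact (σ.tsum_eq fun j => ‖v j‖ ^ (2 : ℝ≥0∞).toReal).le

theorem permOp_apply (σ : Equiv.Perm ℤ) (v : ℓ²(ℤ, ℂ)) (j : ℤ) : permOp σ v j = v (σ j) := rfl

/-- The lattice gradient `(∇v)_j = v_j - v_{σ(j)}`, where `σ(j)` is the predecessor of `j`. -/
noncomputable def grad (σ : Equiv.Perm ℤ) : ℓ²(ℤ, ℂ) →L[ℂ] ℓ²(ℤ, ℂ) :=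
  1 - permOp σ

/-- The operator `∇* a ∇ + b` on `ℓ²(ℤ)`. -/
noncomputable def chainOp (σ : Equiv.Perm ℤ) (a b : ℓ^∞(ℤ, ℂ)) : ℓ²(ℤ, ℂ) →L[ℂ] ℓ²(ℤ, ℂ) :=
  ContinuousLinearMap.adjoint (grad σ) ∘L mulOp a ∘L grad σ + mulOp b

/-- The predecessor map `j ↦ j - 1` of the infinite chain. -/
def pred : Equiv.Perm ℤ := Equiv.subRight 1

/-- The predecessor map of the periodic chain on `ℤ_n = {j | -n < j ≤ n}`: it sends `j` to `j - 1`
for `1 - n < j ≤ n` and `1 - n` to `n`. Integers outside `ℤ_n` are fixed, so that the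
corresponding gradient vanishes there. -/
def predRing (n : ℕ) : Equiv.Perm ℤ where
  toFun j := if -(n : ℤ) < j ∧ j ≤ n then (if j = 1 - n then (n : ℤ) else j - 1) else j
  invFun j := if -(n : ℤ) < j ∧ j ≤ n then (if j = n then 1 - (n : ℤ) else j + 1) else j
  left_inv j := by grind
  right_inv j := by grind

/-- The phase space `ℓ²(ℤ)²`, with its Hilbert space norm. -/
abbrev Phase : Type := WithLp 2 (ℓ²(ℤ, ℂ) × ℓ²(ℤ, ℂ))

/-- The operator `(v, ν) ↦ (ν, -H v)` on `ℓ²(ℤ)²`. -/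
noncomputable def vectorField (H : ℓ²(ℤ, ℂ) →L[ℂ] ℓ²(ℤ, ℂ)) : Phase →L[ℂ] Phase :=
  (WithLp.prodContinuousLinearEquiv 2 ℂ ℓ²(ℤ, ℂ) ℓ²(ℤ, ℂ)).symm.toContinuousLinearMap ∘L
    ((WithLp.sndL 2 ℂ ℓ²(ℤ, ℂ) ℓ²(ℤ, ℂ)).prod (-(H ∘L WithLp.fstL 2 ℂ ℓ²(ℤ, ℂ) ℓ²(ℤ, ℂ))))

theorem vectorField_apply (H : ℓ²(ℤ, ℂ) →L[ℂ] ℓ²(ℤ, ℂ)) (v ν : ℓ²(ℤ, ℂ)) :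
    vectorField H (WithLp.toLp 2 (v, ν)) = WithLp.toLp 2 (ν, -H v) := rfl

theorem continuous_vectorField : Continuous vectorField := by
  have h : Continuous fun H : ℓ²(ℤ, ℂ) →L[ℂ] ℓ²(ℤ, ℂ) =>
      (WithLp.sndL 2 ℂ ℓ²(ℤ, ℂ) ℓ²(ℤ, ℂ)).prod (-(H ∘L WithLp.fstL 2 ℂ ℓ²(ℤ, ℂ) ℓ²(ℤ, ℂ))) :=
    (ContinuousLinearMap.prodₗᵢ ℂ).continuous.comp
      (continuous_const.prodMk (continuous_id.clm_comp continuous_const).neg)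
  exact continuous_const.clm_comp h

theorem continuous_chainOp (σ : Equiv.Perm ℤ) {a b : ℝ → ℓ^∞(ℤ, ℂ)} (ha : Continuous a)
    (hb : Continuous b) : Continuous fun t => chainOp σ (a t) (b t) := by
  unfold chainOp
  exact (continuous_const.clm_comp ((mulOp.continuous.comp ha).clm_comp continuous_const)).add
    (mulOp.continuous.comp hb)

/-! ### Coefficients -/

/-- A real-valued function `(j, t) ↦ w_j(t)` on `ℤ × ℝ`, continuous and `2π`-periodic in `t`, such
that `cosh(2ρ₀j)^{1/2} w_j(t)` is bounded, uniformly in `j` and `t`, for some `ρ₀ > 0`. -/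
structure DecayingCurve where
  toFun : ℤ → ℝ → ℝ
  continuous' : ∀ j, Continuous (toFun j)
  periodic' : ∀ j, Function.Periodic (toFun j) (2 * Real.pi)
  decay' : ∃ ρ₀ : ℝ, 0 < ρ₀ ∧ ∃ C : ℝ, ∀ (j : ℤ) (t : ℝ),
    √(Real.cosh (2 * ρ₀ * j)) * |toFun j t| ≤ C

namespace DecayingCurve

theorem exists_bound (w : DecayingCurve) : ∃ C : ℝ, ∀ j t, |w.toFun j t| ≤ C := by
  obtain ⟨ρ, -, C, hC⟩ := w.decay'
  refine ⟨C, fun j t => le_trans ?_ (hC j t)⟩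
  exact le_mul_of_one_le_left (abs_nonneg _) (Real.one_le_sqrt.mpr (Real.one_le_cosh _))

/-- The bounded sequence `j ↦ c + w_j(t)`. -/
noncomputable def coeff (c : ℝ) (w : DecayingCurve) (t : ℝ) : ℓ^∞(ℤ, ℂ) :=
  ⟨fun j => ((c + w.toFun j t : ℝ) : ℂ), by
    obtain ⟨C, hC⟩ := w.exists_bound
    refine memℓp_infty ⟨|c| + C, ?_⟩
    rintro _ ⟨j, rfl⟩
    simp only [Complex.norm_real, Real.norm_eq_abs]
    exact (abs_add_le _ _).trans (by gcongr; exact hC j t)⟩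

theorem coeff_apply (c : ℝ) (w : DecayingCurve) (t : ℝ) (j : ℤ) :
    coeff c w t j = ((c + w.toFun j t : ℝ) : ℂ) := rfl

theorem continuous_coeff (c : ℝ) (w : DecayingCurve) : Continuous (coeff c w) := by
  obtain ⟨ρ, hρ, C, hC⟩ := w.decay'
  rw [continuous_iff_continuousAt]
  intro t₀
  rw [ContinuousAt, Metric.tendsto_nhds]
  intro ε hε
  -- far from the origin the coefficients are uniformly small
  have hlim : Filter.Tendsto (fun j : ℤ => √(Real.cosh (2 * ρ * j))) Filter.cofinite
      Filter.atTop := by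
    refine Real.tendsto_sqrt_atTop.comp ?_
    have h1 : Filter.Tendsto (fun j : ℤ => ρ * |(j : ℝ)|) Filter.cofinite Filter.atTop := by
      refine Filter.Tendsto.const_mul_atTop hρ ?_
      have := tendsto_norm_cocompact_atTop (E := ℝ)
      exact this.comp Int.tendsto_coe_cofinite
    refine Filter.tendsto_atTop_mono (fun j => ?_) h1
    rw [← Real.cosh_abs, abs_mul, abs_of_pos (by positivity : 0 < 2 * ρ)]
    have h2 := Real.add_one_le_exp (2 * ρ * |(j : ℝ)|)
    have h3 := Real.exp_pos (-(2 * ρ * |(j : ℝ)|))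
    rw [Real.cosh_eq]
    linarith
  have hfar : ∀ᶠ j : ℤ in Filter.cofinite, ∀ t, |w.toFun j t| ≤ ε / 4 := by
    filter_upwards [hlim.eventually_ge_atTop (max 1 (4 * C / ε))] with j hj t
    have h1 : (1 : ℝ) ≤ √(Real.cosh (2 * ρ * j)) := (le_max_left _ _).trans hj
    have h2 : 4 * C / ε ≤ √(Real.cosh (2 * ρ * j)) := (le_max_right _ _).trans hj
    have h3 := hC j t
    rw [div_le_iff₀ hε] at h2
    by_contra hcon
    push Not at hcon
    nlinarith
  have hnear : ∀ᶠ t in nhds t₀, ∀ j ∈ {j : ℤ | ¬ ∀ t, |w.toFun j t| ≤ ε / 4},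
      |w.toFun j t - w.toFun j t₀| ≤ ε / 2 := by
    rw [Filter.eventually_all_finite (Filter.eventually_cofinite.mp hfar)]
    intro j _
    have := (w.continuous' j).continuousAt (x := t₀)
    filter_upwards [Metric.tendsto_nhds.mp this (ε / 2) (by positivity)] with t ht
    exact (Real.dist_eq _ _ ▸ ht).le
  filter_upwards [hnear] with t ht
  rw [dist_eq_norm]
  refine lt_of_le_of_lt (lp.norm_le_of_forall_le (C := ε / 2) (by positivity) fun j => ?_)
    (by linarith)
  have hj : (coeff c w t - coeff c w t₀) j = ((w.toFun j t - w.toFun j t₀ : ℝ) : ℂ) := by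
    rw [lp.coeFn_sub, Pi.sub_apply, coeff_apply, coeff_apply]
    push_cast
    ring
  rw [hj, Complex.norm_real, Real.norm_eq_abs]
  by_cases hjs : ∀ t, |w.toFun j t| ≤ ε / 4
  · have h1 := hjs t
    have h2 := hjs t₀
    exact (abs_sub _ _).trans (by linarith)
  · exact ht j hjs

/-- The curve `w`, set to zero outside `ℤ_n = {j | -n < j ≤ n}`. -/
noncomputable def truncate (n : ℕ) (w : DecayingCurve) : DecayingCurve where
  toFun j t := if -(n : ℤ) < j ∧ j ≤ n then w.toFun j t else 0
  continuous' j := by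
    split_ifs
    exacts [w.continuous' j, continuous_const]
  periodic' j t := by
    split_ifs
    exacts [w.periodic' j t, rfl]
  decay' := by
    obtain ⟨ρ, hρ, C, hC⟩ := w.decay'
    refine ⟨ρ, hρ, C, fun j t => ?_⟩
    split_ifs
    · exact hC j t
    · have := hC j t
      have h0 : 0 ≤ √(Real.cosh (2 * ρ * j)) * |w.toFun j t| := by positivity
      simpa using h0.trans this

end DecayingCurve

/-! ### The two flows and the spectral set -/

/-- `H(t) = ∇₀* α(t) ∇₀ + β(t)` on `ℓ²(ℤ)`, with `α_j(t) = ᾱ + α̃_j(t)`, `β_j(t) = β̄ + β̃_j(t)` and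
`(∇₀ v)_j = v_j - v_{j-1}`. -/
noncomputable def chainH (αbar βbar : ℝ) (α' β' : DecayingCurve) (t : ℝ) :
    ℓ²(ℤ, ℂ) →L[ℂ] ℓ²(ℤ, ℂ) :=
  chainOp pred (α'.coeff αbar t) (β'.coeff βbar t)

/-- The operator `H_n(t)` of the periodic chain on `ℤ_n = {j | -n < j ≤ n}`, extended to `ℓ²(ℤ)`.
On sequences supported in `ℤ_n` its quadratic form is
`α_{1-n}(t)|v_{1-n} - v_n|² + ∑_{1-n < j ≤ n} α_j(t)|v_j - v_{j-1}|² + ∑_{-n < j ≤ n} β_j(t)|v_j|²`;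
on sequences that vanish on `ℤ_n` it acts as multiplication by the constant `β̄`. -/
noncomputable def ringH (αbar βbar : ℝ) (α' β' : DecayingCurve) (n : ℕ) (t : ℝ) :
    ℓ²(ℤ, ℂ) →L[ℂ] ℓ²(ℤ, ℂ) :=
  chainOp (predRing n) (α'.coeff αbar t) ((β'.truncate n).coeff βbar t)

/-- The time-`t` maps `Φ(t)` of `v' = X(t) v` on `ℓ²(ℤ)²`, where `X(t) (v, ν) = (ν, -H(t) v)`. -/
noncomputable def chainFlow (αbar βbar : ℝ) (α' β' : DecayingCurve) : ℝ → Phase →L[ℂ] Phase :=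
  timeMap (fun t => vectorField (chainH αbar βbar α' β' t))
    (continuous_vectorField.comp (continuous_chainOp pred
      (α'.continuous_coeff αbar) (β'.continuous_coeff βbar)))

/-- The time-`t` maps `Φ_n(t)` of `v' = X_n(t) v` on `ℓ²(ℤ)²`, where
`X_n(t) (v, ν) = (ν, -H_n(t) v)`. -/
noncomputable def ringFlow (αbar βbar : ℝ) (α' β' : DecayingCurve) (n : ℕ) : ℝ → Phase →L[ℂ] Phase :=
  timeMap (fun t => vectorField (ringH αbar βbar α' β' n t))
    (continuous_vectorField.comp (continuous_chainOp (predRing n)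
      (α'.continuous_coeff αbar) ((β'.truncate n).continuous_coeff βbar)))

/-- The Fourier symbol `h₀(φ) = 2ᾱ(1 - cos φ) + β̄` of `ᾱ ∇₀*∇₀ + β̄`. -/
noncomputable def symbol (αbar βbar φ : ℝ) : ℝ := 2 * αbar * (1 - Real.cos φ) + βbar

/-- The set `Σ₀ᵉ = {e^{2πz} : z ∈ ℂ, -z² ∈ R₀}`, with `R₀` the range of `h₀` on the real line. -/
noncomputable def essSpec (αbar βbar : ℝ) : Set ℂ :=
  (fun z : ℂ => Complex.exp (2 * Real.pi * z)) ''
    {z : ℂ | -z ^ 2 ∈ Set.range (fun φ : ℝ => (symbol αbar βbar φ : ℂ))}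

end LatticeFlow

/-! Write `Φ` and `Φ_n` for the flows over one period and `Ψ`, `Ψ_n` for the free flows generated by
`ᾱ ∇*∇ + β̄` on the line and on the rings; `S` is `essSpec`. The proof is perturbation theory with a
collectively compact perturbation.

Compactness: let `M` be multiplication by `1 / (1 + |j|)`, a compact operator. The coefficients
decay exponentially, so they still decay after multiplication by `1 + |j|`. Moreover the gradients
pass through `M` at bounded cost, on the line and on every ring, because neighbouring weights are
comparable, also across the edge joining `1 - n` and `n`. Duhamel's formula then gives `Φ = Ψ + M Z`
and `Φ_n = Ψ_n + M Z_n` with one fixed `M` and with `‖Z_n‖` bounded (`exists_timeMap_generator_eq`).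
Strongly, but not in general in norm, `Ψ_n → Ψ` and `Φ_n → Φ`.

Free flows: a free generator `X` need not be normal, but `(z - exp X)(z - exp (-X)) = z² + 1 - z
(exp X + exp (-X))` depends only on `X²`, hence is a function of the self-adjoint operator `∇*∇`,
whose spectrum lies in `[0, 4]`. Functional calculus inverts it off `S`, with a bound that does not
see `n` (`exists_free_resolvent_bound`).

Spectra: off `S`, points of the spectra of `Φ` and `Φ_n` are eigenvalues by the Fredholm
alternative. If `Φ` has no spectrum on a compact set disjoint from `S`, then `z - Φ_n` is bounded
below there, uniformly for large `n` (`exists_lower_bound_of_collectively_compact`). On a small disc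
this excludes accumulation at a point that is not an eigenvalue of `Φ`. Conversely, an eigenvalue
`μ` of `Φ` is isolated (`eventually_notMem_spectrum_add_compact`). If the disc around it contained
no spectrum of `Φ_n` for infinitely many `n`, the maximum principle would carry the resolvent bound
from the circle to `μ`, contradicting `(μ - Φ_n) v → 0` for an eigenvector `v` of `Φ`. -/

namespace LatticeFlow

/-! ### Compact perturbations and their spectra -/

section Compact

open Filter Topology

/-- To solve `y - g (f y) = v`, solve `x - f (g x) = f v` and put `y = g x + v`. This reduces
invertibility on the whole space to a finite-dimensional subspace. -/
theorem bijective_sub_comp_swap {R M N : Type*} [Ring R] [AddCommGroup M] [AddCommGroup N]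
    [Module R M] [Module R N] (f : N →ₗ[R] M) (g : M →ₗ[R] N)
    (h : Function.Bijective (fun x => x - f (g x))) :
    Function.Bijective (fun y => y - g (f y)) := by
  constructor
  · refine (injective_iff_map_eq_zero (LinearMap.id - g ∘ₗ f)).mpr fun v hv => ?_
    have hv' : v = g (f v) := sub_eq_zero.mp hv
    have h0 : f v = 0 := h.1 (by simp [← hv'])
    rw [hv', h0, map_zero]
  · intro v
    obtain ⟨x, hx⟩ := h.2 (f v)
    have hx' : x = f v + f (g x) := sub_eq_iff_eq_add.mp hx
    refine ⟨g x + v, ?_⟩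
    have : f (g x + v) = x := by rw [map_add, add_comm, ← hx']
    simp only [this]
    abel

theorem bijective_sub_comp_comm {R M N : Type*} [Ring R] [AddCommGroup M] [AddCommGroup N]
    [Module R M] [Module R N] (f : N →ₗ[R] M) (g : M →ₗ[R] N) :
    Function.Bijective (fun x => x - f (g x)) ↔ Function.Bijective (fun y => y - g (f y)) :=
  ⟨bijective_sub_comp_swap f g, bijective_sub_comp_swap g f⟩

variable {E : Type*} [NormedAddCommGroup E] [InnerProductSpace ℂ E]

/-- A compact operator is approximated in norm by its compressions to finite-dimensional ranges. -/
theorem exists_finiteDimensional_norm_le {K : E →L[ℂ] E} (hK : IsCompactOperator K) {ε : ℝ}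
    (hε : 0 < ε) : ∃ (V : Submodule ℂ E) (_ : FiniteDimensional ℂ V),
      ‖(1 - V.starProjection) * K‖ ≤ ε := by
  have hc := hK.isCompact_closure_image_closedBall 1
  -- The subspace is spanned by a finite `ε`-net of the closure of the image of the unit ball.
  obtain ⟨t, -, ht, htc⟩ := hc.finite_cover_balls hε
  have : FiniteDimensional ℂ (Submodule.span ℂ t) := FiniteDimensional.span_of_finite ℂ ht
  refine ⟨Submodule.span ℂ t, this, ContinuousLinearMap.opNorm_le_of_unit_norm hε.le fun x hx => ?_⟩
  have hx' : K x ∈ closure (K '' Metric.closedBall 0 1) :=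
    subset_closure ⟨x, by simp [hx], rfl⟩
  obtain ⟨y, hy, hyx⟩ := Set.mem_iUnion₂.mp (htc hx')
  have hyV : y ∈ Submodule.span ℂ t := Submodule.subset_span hy
  set P := (Submodule.span ℂ t).starProjection
  have h1 : ((1 - P) * K) x = (1 - P) (K x - y) := by
    have h0 : (1 - P) y = 0 := by
      simp [P, Submodule.starProjection_eq_self_iff.mpr hyV]
    rw [map_sub, h0, sub_zero]; rfl
  have h2 : 1 - P = (Submodule.span ℂ t)ᗮ.starProjection := by
    rw [Submodule.starProjection_orthogonal]; rfl
  rw [h1, h2]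
  refine (Submodule.norm_starProjection_apply_le _ _).trans ?_
  rw [← dist_eq_norm]
  exact (Metric.mem_ball.mp hyx).le

variable [CompleteSpace E]

/-- The projection factors as inclusion after projection onto `V`. Swapping the two factors turns
the operator on `E` into an endomorphism of `V`, where a determinant decides. -/
theorem isUnit_one_sub_iff_det {V : Submodule ℂ E} [FiniteDimensional ℂ V] (B : E →L[ℂ] E) :
    IsUnit (1 - V.starProjection * B) ↔
      LinearMap.det (1 - (V.orthogonalProjectionOnto ∘L B ∘L V.subtypeL : V →L[ℂ] V) :
        V →ₗ[ℂ] V) ≠ 0 := by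
  rw [← isUnit_iff_ne_zero, ← LinearMap.isUnit_iff_isUnit_det,
    ContinuousLinearMap.isUnit_iff_bijective, Module.End.isUnit_iff]
  exact bijective_sub_comp_comm V.subtype
    ((V.orthogonalProjectionOnto ∘L B : E →L[ℂ] V) : E →ₗ[ℂ] V)

theorem analyticAt_det {V : Type*} [NormedAddCommGroup V] [NormedSpace ℂ V]
    [FiniteDimensional ℂ V] {T : ℂ → V →L[ℂ] V} {z : ℂ}
    (hT : ∀ᶠ w in 𝓝 z, DifferentiableAt ℂ T w) :
    AnalyticAt ℂ (fun w => LinearMap.det (T w : V →ₗ[ℂ] V)) z := by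
  rw [Complex.analyticAt_iff_eventually_differentiableAt]
  filter_upwards [hT] with w hw
  let b := Module.finBasis ℂ V
  have hentry : ∀ i j, DifferentiableAt ℂ
      (fun w => LinearMap.toMatrix b b (T w : V →ₗ[ℂ] V) i j) w := by
    intro i j
    let ev : (V →L[ℂ] V) →L[ℂ] ℂ :=
      (LinearMap.toContinuousLinearMap (b.coord i)) ∘L ContinuousLinearMap.apply ℂ V (b j)
    have : (fun w => LinearMap.toMatrix b b (T w : V →ₗ[ℂ] V) i j) = fun w => ev (T w) := by
      funext w
      simp [ev, LinearMap.toMatrix_apply]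
    rw [this]
    exact ev.differentiableAt.comp w hw
  have : (fun w => LinearMap.det (T w : V →ₗ[ℂ] V)) = fun w =>
      (LinearMap.toMatrix b b (T w : V →ₗ[ℂ] V)).det := by
    funext w; rw [LinearMap.det_toMatrix]
  rw [this]
  simp only [Matrix.det_apply]
  refine DifferentiableAt.fun_sum fun s _ => DifferentiableAt.const_smul ?_ _
  exact DifferentiableAt.fun_finsetProd fun i _ => hentry _ _

theorem algebraMap_sub_isUnit {R A : Type*} [CommRing R] [Ring A] [Algebra R A] {a : A} {r : R}
    (h : r ∉ spectrum R a) : IsUnit (algebraMap R A r - a) := spectrum.notMem_iff.mp h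

/-- Off the spectrum of `Ψ`, the spectrum of a compact perturbation of `Ψ` is locally either
everything or at most one point. -/
theorem spectrum_add_compact_dichotomy (Ψ : E →L[ℂ] E) {K : E →L[ℂ] E}
    (hK : IsCompactOperator K) {z : ℂ} (hz : z ∉ spectrum ℂ Ψ) :
    (∀ᶠ w in 𝓝 z, w ∈ spectrum ℂ (Ψ + K)) ∨ ∀ᶠ w in 𝓝[≠] z, w ∉ spectrum ℂ (Ψ + K) := by
  set R : ℂ → E →L[ℂ] E := resolvent Ψ with hR
  have hzR : ∀ᶠ w in 𝓝 z, w ∉ spectrum ℂ Ψ :=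
    (spectrum.isClosed Ψ).isOpen_compl.mem_nhds hz
  have hRd : ∀ w, w ∉ spectrum ℂ Ψ → DifferentiableAt ℂ R w := fun w hw =>
    (spectrum.hasDerivAt_resolvent_const_left (spectrum.mem_resolventSet_iff.mpr
      (algebraMap_sub_isUnit hw))).differentiableAt
  have hRz : ContinuousAt R z := (hRd z hz).continuousAt
  -- Near `z` the resolvent has norm below `‖R z‖ + 1`, so this choice keeps `(1 - P) K R w` below
  -- `1/2` in norm and the Neumann series inverts `G w`.
  obtain ⟨V, hV, hVK⟩ := exists_finiteDimensional_norm_le hK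
    (show 0 < 1 / (2 * (‖R z‖ + 1)) by positivity)
  set P := V.starProjection
  have hsmall : ∀ᶠ w in 𝓝 z, ‖(1 - P) * K * R w‖ < 1 := by
    have : ∀ᶠ w in 𝓝 z, ‖R w‖ < ‖R z‖ + 1 := by
      have := hRz.norm.eventually_lt (continuousAt_const (y := ‖R z‖ + 1))
        (lt_add_one _)
      exact this
    filter_upwards [this] with w hw
    calc ‖(1 - P) * K * R w‖ ≤ ‖(1 - P) * K‖ * ‖R w‖ := norm_mul_le _ _
      _ ≤ 1 / (2 * (‖R z‖ + 1)) * (‖R z‖ + 1) := by gcongr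
      _ < 1 := by
        have : 0 < ‖R z‖ + 1 := by positivity
        field_simp; norm_num
  set G : ℂ → E →L[ℂ] E := fun w => 1 - (1 - P) * K * R w with hG
  set B : ℂ → E →L[ℂ] E := fun w => K * R w * Ring.inverse (G w) with hB
  have hBd : ∀ᶠ w in 𝓝 z, DifferentiableAt ℂ B w := by
    filter_upwards [hzR, hsmall] with w hw hw1
    have h1 : DifferentiableAt ℂ G w :=
      (differentiableAt_const _).sub ((differentiableAt_const _).mul (hRd w hw))
    exact ((differentiableAt_const _).mul (hRd w hw)).mul
      (h1.inverse (isUnit_one_sub_of_norm_lt_one hw1))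
  set f : ℂ → ℂ := fun w => LinearMap.det
    (1 - (V.orthogonalProjectionOnto ∘L B w ∘L V.subtypeL : V →L[ℂ] V) : V →ₗ[ℂ] V) with hf
  have hfa : AnalyticAt ℂ f z := by
    refine analyticAt_det (T := fun w => 1 - V.orthogonalProjectionOnto ∘L B w ∘L V.subtypeL) ?_
    filter_upwards [hBd] with w hw
    exact (differentiableAt_const _).sub ((differentiableAt_const _).clm_comp
      (hw.clm_comp (differentiableAt_const _)))
  have hiff : ∀ᶠ w in 𝓝 z, (f w = 0 ↔ w ∈ spectrum ℂ (Ψ + K)) := by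
    filter_upwards [hzR, hsmall] with w hw hw1
    have hu : IsUnit (G w) := isUnit_one_sub_of_norm_lt_one hw1
    have hu' := algebraMap_sub_isUnit hw
    rw [← not_iff_not, ← ne_eq, hf, ← isUnit_one_sub_iff_det, spectrum.notMem_iff]
    -- `w - Ψ - K = (1 - K R)(w - Ψ)`, and `1 - K R = G - P K R = (1 - P B) G`. Only the factor `1 -
    -- P B` can fail to be invertible, and it is governed by the analytic function `f`.
    have hfac : algebraMap ℂ (E →L[ℂ] E) w - (Ψ + K) =
        (1 - P * B w) * (G w * (algebraMap ℂ (E →L[ℂ] E) w - Ψ)) := by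
      have h1 : R w * (algebraMap ℂ (E →L[ℂ] E) w - Ψ) = 1 := Ring.inverse_mul_cancel _ hu'
      have h2 : (1 - P * B w) * G w = 1 - K * R w := by
        have h3 : B w * G w = K * R w := by
          rw [hB, mul_assoc, Ring.inverse_mul_cancel _ hu, mul_one]
        rw [sub_mul, mul_assoc, h3, one_mul, hG]
        noncomm_ring
      rw [← mul_assoc, h2, sub_mul, mul_assoc, h1]
      noncomm_ring
    rw [hfac]
    obtain ⟨u, hu0⟩ := hu.mul hu'
    rw [← hu0]
    exact (Units.isUnit_mul_units _ u).symm
  rcases hfa.eventually_eq_zero_or_eventually_ne_zero with h | h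
  · left
    filter_upwards [h, hiff] with w h1 h2 using h2.mp h1
  · right
    filter_upwards [h, hiff.filter_mono nhdsWithin_le_nhds] with w h1 h2
    exact fun h3 => h1 (h2.mpr h3)

/-- The Fredholm alternative for compact perturbations. -/
theorem hasEigenvalue_add_compact {Ψ K : E →L[ℂ] E} (hK : IsCompactOperator K) {z : ℂ}
    (hz : z ∉ spectrum ℂ Ψ) (hz' : z ∈ spectrum ℂ (Ψ + K)) :
    Module.End.HasEigenvalue ((Ψ + K : E →L[ℂ] E) : E →ₗ[ℂ] E) z := by
  have hu := algebraMap_sub_isUnit hz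
  set D := algebraMap ℂ (E →L[ℂ] E) z - Ψ with hD
  have hc : IsCompactOperator (Ring.inverse D * K : E →L[ℂ] E) := hK.clm_comp (Ring.inverse D)
  have hfac : algebraMap ℂ (E →L[ℂ] E) z - (Ψ + K) = D * (1 - Ring.inverse D * K) := by
    rw [mul_sub, ← mul_assoc, Ring.mul_inverse_cancel _ hu, hD]
    noncomm_ring
  rcases hc.hasEigenvalue_or_mem_resolventSet (one_ne_zero (α := ℂ)) with h | h
  · obtain ⟨x, hx⟩ := h.exists_hasEigenvector
    refine Module.End.hasEigenvalue_of_hasEigenvector (x := x)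
      ⟨Module.End.mem_eigenspace_iff.mpr ?_, hx.2⟩
    have h1 : (Ring.inverse D * K) x = x := by simpa using hx.apply_eq_smul
    have h2 : (algebraMap ℂ (E →L[ℂ] E) z - (Ψ + K)) x = 0 := by
      have h0 : (1 - Ring.inverse D * K) x = 0 := by
        rw [sub_apply, h1]
        exact sub_self x
      rw [hfac]
      exact (congrArg D h0).trans (map_zero D)
    have h3 : z • x - (Ψ + K) x = 0 := by simpa [Algebra.algebraMap_eq_smul_one] using h2
    exact (sub_eq_zero.mp h3).symm
  · exfalso
    apply spectrum.notMem_iff.mpr _ hz'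
    rw [hfac]
    refine hu.mul ?_
    have := spectrum.mem_resolventSet_iff.mp h
    simpa using this

end Compact

/-! ### Discreteness and convergence of spectra under collectively compact perturbations -/

section Approximation

open Filter Topology

variable {E : Type*} [NormedAddCommGroup E] [InnerProductSpace ℂ E] [CompleteSpace E]

/-- If the spectrum of `Ψ` lies in a closed subset `S` of the union of the unit circle and the real
axis, then the spectrum of an invertible compact perturbation of `Ψ` is discrete off `S`. -/
theorem eventually_notMem_spectrum_add_compact [Nontrivial E] (Ψ : E →L[ℂ] E) {K : E →L[ℂ] E}
    (hK : IsCompactOperator K) {S : Set ℂ} (hS : IsClosed S) (hSsub : ∀ z ∈ S, ‖z‖ = 1 ∨ z.im = 0)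
    (hΨ : spectrum ℂ Ψ ⊆ S) (hunit : IsUnit (Ψ + K)) {μ : ℂ} (hμ : μ ∉ S) :
    ∀ᶠ w in 𝓝[≠] μ, w ∉ spectrum ℂ (Ψ + K) := by
  have hdich : ∀ z ∉ S, (∀ᶠ w in 𝓝 z, w ∈ spectrum ℂ (Ψ + K)) ∨
      ∀ᶠ w in 𝓝[≠] z, w ∉ spectrum ℂ (Ψ + K) := fun z hz =>
    spectrum_add_compact_dichotomy Ψ hK fun h => hz (hΨ h)
  refine (hdich μ hμ).resolve_left fun hin => ?_
  -- By the dichotomy the complement of `S` splits into two disjoint open sets, so a connected set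
  -- off `S` that meets `O` stays in `O`.
  set O : Set ℂ := {z | z ∉ S ∧ ∀ᶠ w in 𝓝 z, w ∈ spectrum ℂ (Ψ + K)} with hO
  set O' : Set ℂ := {z | z ∉ S ∧ ∀ᶠ w in 𝓝[≠] z, w ∉ spectrum ℂ (Ψ + K)} with hO'
  have hOo : IsOpen O := by
    refine isOpen_iff_mem_nhds.mpr fun z hz => ?_
    filter_upwards [hS.isOpen_compl.mem_nhds hz.1, eventually_eventually_nhds.mpr hz.2]
      with w h1 h2 using ⟨h1, h2⟩
  have hO'o : IsOpen O' := by
    refine isOpen_iff_mem_nhds.mpr fun z hz => ?_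
    have h2 := hz.2
    rw [← eventually_eventually_nhdsWithin, eventually_nhdsWithin_iff] at h2
    filter_upwards [hS.isOpen_compl.mem_nhds hz.1, h2] with w h1 h3
    refine ⟨h1, ?_⟩
    by_cases hwz : w = z
    · rw [hwz]; exact hz.2
    · have h4 := h3 hwz
      rw [isOpen_compl_singleton.nhdsWithin_eq hwz] at h4
      exact h4.filter_mono nhdsWithin_le_nhds
  have hdisj : Disjoint O O' := by
    rw [Set.disjoint_left]
    intro z h1 h2
    obtain ⟨w, hw1, hw2⟩ := ((h1.2.filter_mono nhdsWithin_le_nhds).and h2.2).exists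
    exact hw2 hw1
  have hcov : Sᶜ ⊆ O ∪ O' := fun z hz => (hdich z hz).imp (fun h => ⟨hz, h⟩) fun h => ⟨hz, h⟩
  -- Off the real axis the ray through `ν` can meet `S` only on the unit circle.
  obtain ⟨ν, hν, hνim⟩ : ∃ ν ∈ O, ν.im ≠ 0 := by
    by_cases him : μ.im = 0
    · have ht : Tendsto (fun t : ℝ => μ + t * Complex.I) (𝓝[≠] 0) (𝓝 μ) := by
        have : Continuous (fun t : ℝ => μ + t * Complex.I) := by fun_prop
        simpa using (this.tendsto 0).mono_left nhdsWithin_le_nhds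
      obtain ⟨t, h1, h2⟩ := ((ht.eventually (hOo.mem_nhds ⟨hμ, hin⟩)).and
        self_mem_nhdsWithin).exists
      exact ⟨_, h1, by simpa [him] using h2⟩
    · exact ⟨μ, ⟨hμ, hin⟩, him⟩
  have hray : ∀ I : Set ℝ, IsPreconnected I → (1 : ℝ) ∈ I →
      (∀ t ∈ I, (t : ℂ) * ν ∉ S) → ∀ t ∈ I, (t : ℂ) * ν ∈ spectrum ℂ (Ψ + K) := by
    intro I hI h1 hIS t ht
    have himg : IsPreconnected ((fun t : ℝ => (t : ℂ) * ν) '' I) :=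
      hI.image _ (by fun_prop)
    have := himg.subset_left_of_subset_union hOo hO'o hdisj
      (by rintro _ ⟨s, hs, rfl⟩; exact hcov (hIS s hs))
      ⟨ν, (⟨1, h1, by simp⟩ : ∃ t, t ∈ I ∧ (t : ℂ) * ν = ν), hν⟩
    exact (this ⟨t, ht, rfl⟩).2.self_of_nhds
  have hν0 : 0 < ‖ν‖ := norm_pos_iff.mpr fun h => hνim (by simp [h])
  have hnotS : ∀ t : ℝ, 0 < t → |t| * ‖ν‖ ≠ 1 → (t : ℂ) * ν ∉ S := by
    intro t ht h1 hmem
    rcases hSsub _ hmem with h | h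
    · exact h1 (by simpa using h)
    · have : t * ν.im = 0 := by simpa using h
      rcases mul_eq_zero.mp this with h | h
      exacts [ht.ne' h, hνim h]
  -- `S` may contain the whole unit circle, so the ray is followed away from it: outwards it
  -- contradicts boundedness of the spectrum, inwards it contradicts invertibility at `0`.
  rcases le_or_gt 1 ‖ν‖ with hge | hlt
  · have h := hray (Set.Ici 1) isPreconnected_Ici (by simp) (by
      intro t ht
      have ht' : (1 : ℝ) ≤ t := ht
      rcases ht'.eq_or_lt with rfl | ht1
      · simpa using hν.1
      · refine hnotS t (by linarith) ?_
        rw [abs_of_pos (by linarith)]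
        nlinarith)
    have h2 := h (‖Ψ + K‖ + 1) (by simp)
    have h3 := spectrum.norm_le_norm_of_mem h2
    rw [norm_mul, Complex.norm_real, Real.norm_eq_abs, abs_of_nonneg (by positivity)] at h3
    nlinarith [norm_nonneg (Ψ + K)]
  · have h := hray (Set.Ioc 0 1) isPreconnected_Ioc (by simp) (by
      intro t ht
      refine hnotS t ht.1 ?_
      rw [abs_of_pos ht.1]
      nlinarith [ht.1, ht.2])
    have h0 : (0 : ℂ) ∉ spectrum ℂ (Ψ + K) := by
      rw [spectrum.zero_notMem_iff]; exact hunit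
    have ht : Tendsto (fun t : ℝ => (t : ℂ) * ν) (𝓝[>] 0) (𝓝 0) := by
      have : Continuous (fun t : ℝ => (t : ℂ) * ν) := by fun_prop
      simpa using (this.tendsto 0).mono_left nhdsWithin_le_nhds
    obtain ⟨t, h1, h2⟩ := ((ht.eventually ((spectrum.isClosed (𝕜 := ℂ)
      (Ψ + K)).isOpen_compl.mem_nhds h0)).and (Ioc_mem_nhdsGT one_pos)).exists
    exact h1 (h t h2)

/-- Resolvents of collectively compact perturbations are eventually bounded, uniformly on compact
sets on which the limit has no spectrum. -/
theorem exists_lower_bound_of_collectively_compact {Ψ Φ M : E →L[ℂ] E} {Ψn Φn Zn : ℕ → E →L[ℂ] E}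
    (hM : IsCompactOperator M) (hΦn : ∀ n, Φn n = Ψn n + M * Zn n) {C : ℝ}
    (hZ : ∀ n, ‖Zn n‖ ≤ C) {D : ℝ} (hD : ∀ n, ‖Φn n‖ ≤ D)
    (hΨlim : ∀ x, Tendsto (fun n => Ψn n x) atTop (𝓝 (Ψ x)))
    (hΦlim : ∀ x, Tendsto (fun n => Φn n x) atTop (𝓝 (Φ x))) {Γ : Set ℂ} (hΓ : IsCompact Γ)
    (hΓΨ : ∀ z ∈ Γ, z ∉ spectrum ℂ Ψ)
    (hΓn : ∀ z ∈ Γ, ∃ c : ℝ, 0 < c ∧ ∀ n x, c * ‖x‖ ≤ ‖z • x - Ψn n x‖)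
    (hΓΦ : ∀ z ∈ Γ, z ∉ spectrum ℂ Φ) :
    ∃ c : ℝ, 0 < c ∧ ∀ᶠ n in atTop, ∀ z ∈ Γ, ∀ x, c * ‖x‖ ≤ ‖z • x - Φn n x‖ := by
  by_contra hcon
  push Not at hcon
  obtain ⟨φ, hφ, hbad⟩ := extraction_forall_of_frequently fun k : ℕ =>
    hcon (1 / ((k : ℝ) + 1)) (by positivity)
  choose z hz y hy using hbad
  have hy0 : ∀ k, 0 < ‖y k‖ := fun k => by
    rw [norm_pos_iff]
    intro h0
    simpa [h0] using hy k
  -- Unit approximate eigenvectors along a strictly increasing sequence of indices; the aim is a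
  -- limit that is an exact eigenvector of `Φ`.
  set x : ℕ → E := fun k => (‖y k‖⁻¹ : ℂ) • y k with hx
  have hx1 : ∀ k, ‖x k‖ = 1 := fun k => by
    simp [hx, norm_smul, (hy0 k).ne']
  have hxs : ∀ k, ‖z k • x k - Φn (φ k) (x k)‖ ≤ 1 / ((k : ℝ) + 1) := fun k => by
    have : z k • x k - Φn (φ k) (x k) = (‖y k‖⁻¹ : ℂ) • (z k • y k - Φn (φ k) (y k)) := by
      rw [hx, map_smul, smul_sub, smul_comm]
    rw [this, norm_smul, norm_inv, Complex.norm_real, norm_norm, inv_mul_le_iff₀ (hy0 k), mul_comm]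
    exact (hy k).le
  obtain ⟨z₀, hz₀, ψ, hψ, hzlim⟩ := hΓ.tendsto_subseq hz
  -- Here the common factor `M` matters: all vectors `M (Zn x)` lie in one relatively compact set,
  -- although `n` varies.
  have hcomp := hM.isCompact_closure_image_closedBall C
  obtain ⟨g, -, θ, hθ, hglim⟩ := hcomp.tendsto_subseq
    (x := fun k => M (Zn (φ (ψ k)) (x (ψ k)))) fun k => by
      refine subset_closure ⟨_, ?_, rfl⟩
      rw [mem_closedBall_zero_iff]
      refine ((Zn _).le_opNorm _).trans ?_
      rw [hx1, mul_one]
      exact hZ _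
  -- pass to the subsequence
  set m : ℕ → ℕ := fun k => φ (ψ (θ k)) with hm
  have hmlim : Tendsto m atTop atTop :=
    (hφ.comp (hψ.comp hθ)).tendsto_atTop
  set u : ℕ → E := fun k => x (ψ (θ k)) with hu
  have hu1 : ∀ k, ‖u k‖ = 1 := fun k => hx1 _
  set ζ : ℕ → ℂ := fun k => z (ψ (θ k)) with hζ
  have hζlim : Tendsto ζ atTop (𝓝 z₀) := hzlim.comp hθ.tendsto_atTop
  have hglim' : Tendsto (fun k => M (Zn (m k) (u k))) atTop (𝓝 g) := hglim
  have hres : Tendsto (fun k => ζ k • u k - Φn (m k) (u k)) atTop (𝓝 0) := by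
    refine squeeze_zero_norm (fun k => hxs (ψ (θ k))) ?_
    exact (tendsto_one_div_add_atTop_nhds_zero_nat (𝕜 := ℝ)).comp
      ((hψ.comp hθ).tendsto_atTop)
  have hzu : Tendsto (fun k => (z₀ - ζ k) • u k) atTop (𝓝 0) := by
    rw [tendsto_zero_iff_norm_tendsto_zero]
    simp only [norm_smul, hu1, mul_one]
    have : Tendsto (fun k => z₀ - ζ k) atTop (𝓝 0) := by
      simpa using hζlim.const_sub z₀
    simpa using this.norm
  obtain ⟨c, hc, hlow⟩ := hΓn z₀ hz₀
  have hunit := algebraMap_sub_isUnit (hΓΨ z₀ hz₀)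
  -- The only candidate for the limit is `w = (z₀ - Ψ)⁻¹ g`. Since `(z₀ - Ψn)(u - w) → 0`, the
  -- uniform lower bound for the free operators at `z₀` forces `u → w`.
  obtain ⟨w, hw⟩ : ∃ w, z₀ • w - Ψ w = g := by
    obtain ⟨w, hw⟩ := (ContinuousLinearMap.isUnit_iff_bijective.mp hunit).2 g
    exact ⟨w, by simpa [Algebra.algebraMap_eq_smul_one] using hw⟩
  have hdiff : Tendsto (fun k => z₀ • (u k - w) - Ψn (m k) (u k - w)) atTop (𝓝 0) := by
    have h1 : Tendsto (fun k => z₀ • w - Ψn (m k) w) atTop (𝓝 g) := by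
      rw [← hw]
      exact ((hΨlim w).comp hmlim).const_sub _
    have h2 := ((hzu.add hres).add hglim').sub h1
    simp only [add_zero, zero_add, sub_self] at h2
    refine h2.congr fun k => ?_
    rw [hΦn, map_sub, smul_sub, sub_smul, add_apply, mul_apply_eq_comp]
    abel
  have hulim : Tendsto u atTop (𝓝 w) := by
    rw [tendsto_iff_norm_sub_tendsto_zero]
    refine squeeze_zero (fun k => norm_nonneg _)
      (fun k => (le_div_iff₀' hc).mpr (hlow (m k) (u k - w))) ?_
    simpa using hdiff.norm.div_const c
  have hw1 : ‖w‖ = 1 := by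
    refine tendsto_nhds_unique hulim.norm ?_
    simp only [hu1]
    exact tendsto_const_nhds
  have hΦu : Tendsto (fun k => Φn (m k) (u k)) atTop (𝓝 (Φ w)) := by
    have h1 : Tendsto (fun k => Φn (m k) (u k - w)) atTop (𝓝 0) := by
      refine squeeze_zero_norm (fun k => ((Φn (m k)).le_opNorm _).trans
        (mul_le_mul_of_nonneg_right (hD _) (norm_nonneg _))) ?_
      simpa using (tendsto_iff_norm_sub_tendsto_zero.mp hulim).const_mul D
    have h2 := h1.add ((hΦlim w).comp hmlim)
    rw [zero_add] at h2
    refine h2.congr fun k => ?_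
    simp
  have hzero : z₀ • w - Φ w = 0 := tendsto_nhds_unique ((hζlim.smul hulim).sub hΦu) hres
  have hinj := (ContinuousLinearMap.isUnit_iff_bijective.mp
    (algebraMap_sub_isUnit (hΓΦ z₀ hz₀))).1
  have hw0 : w = 0 := hinj (by simpa [Algebra.algebraMap_eq_smul_one] using hzero)
  simp [hw0] at hw1

/-- Spectral convergence for collectively compact, strongly convergent perturbations: off the
closed set `S`, the eigenvalues of the limit are the limit points of the spectra. -/
theorem hasEigenvalue_iff_mapClusterPt [Nontrivial E] {Ψ Φ M Z : E →L[ℂ] E}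
    {Ψn Φn Zn : ℕ → E →L[ℂ] E} {S : Set ℂ} (hS : IsClosed S)
    (hSsub : ∀ z ∈ S, ‖z‖ = 1 ∨ z.im = 0) (hM : IsCompactOperator M) (hΦ : Φ = Ψ + M * Z)
    (hΦn : ∀ n, Φn n = Ψn n + M * Zn n) {C : ℝ}
    (hZ : ∀ n, ‖Zn n‖ ≤ C) {D : ℝ} (hD : ∀ n, ‖Φn n‖ ≤ D)
    (hΨlim : ∀ x, Tendsto (fun n => Ψn n x) atTop (𝓝 (Ψ x)))
    (hΦlim : ∀ x, Tendsto (fun n => Φn n x) atTop (𝓝 (Φ x)))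
    (hΨ : spectrum ℂ Ψ ⊆ S) (hΨn : ∀ n, spectrum ℂ (Ψn n) ⊆ S)
    (hlow : ∀ z ∉ S, ∃ c : ℝ, 0 < c ∧ ∀ n x, c * ‖x‖ ≤ ‖z • x - Ψn n x‖)
    (hunit : IsUnit Φ) {μ : ℂ} (hμ : μ ∉ S) :
    Module.End.HasEigenvalue (Φ : E →ₗ[ℂ] E) μ ↔
      ∃ l : ℕ → ℂ, (∀ n, 1 ≤ n → l n ∈ spectrum ℂ (Φn n)) ∧ MapClusterPt μ atTop l := by
  have hMZ : ∀ Y : E →L[ℂ] E, IsCompactOperator (M * Y : E →L[ℂ] E) := fun Y => hM.comp_clm Y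
  have hbound : ∀ Γ : Set ℂ, IsCompact Γ → (∀ z ∈ Γ, z ∉ S) → (∀ z ∈ Γ, z ∉ spectrum ℂ Φ) →
      ∃ c : ℝ, 0 < c ∧ ∀ᶠ n in atTop, ∀ z ∈ Γ, ∀ x, c * ‖x‖ ≤ ‖z • x - Φn n x‖ :=
    fun Γ hΓ h1 h2 => exists_lower_bound_of_collectively_compact hM hΦn hZ hD hΨlim hΦlim hΓ
      (fun z hz h => h1 z hz (hΨ h)) (fun z hz => hlow z (h1 z hz)) h2
  constructor
  · intro hev
    have hμΦ := hev.exists_hasEigenvector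
    obtain ⟨v, hv⟩ := hμΦ
    have hvΦ : Φ v = μ • v := hv.apply_eq_smul
    have hpunct : ∀ᶠ w in 𝓝[≠] μ, w ∉ spectrum ℂ Φ := by
      rw [hΦ] at hunit ⊢
      exact eventually_notMem_spectrum_add_compact Ψ (hMZ Z) hS hSsub hΨ hunit hμ
    have hnear : ∀ ε > 0, ∀ᶠ n in atTop, ∃ z ∈ spectrum ℂ (Φn n), dist μ z ≤ ε := by
      intro ε hε
      obtain ⟨δ, hδ, hball⟩ := Metric.eventually_nhds_iff.mp
        ((eventually_nhdsWithin_iff.mp hpunct).and (hS.isOpen_compl.mem_nhds hμ))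
      -- The closed disc of radius `r` avoids `S` and meets the spectrum of `Φ` only at its centre.
      set r := min ε (δ / 2) with hr
      have hr0 : 0 < r := lt_min hε (by positivity)
      have hrδ : r < δ := (min_le_right _ _).trans_lt (by linarith)
      obtain ⟨c, hc, hev⟩ := hbound (Metric.sphere μ r) (isCompact_sphere μ r)
        (fun z hz => (hball (by rw [Metric.mem_sphere.mp hz]; exact hrδ)).2)
        (fun z hz => (hball (by rw [Metric.mem_sphere.mp hz]; exact hrδ)).1
          (Metric.ne_of_mem_sphere hz hr0.ne'))
      by_contra hcon
      have hfreq := (not_eventually.mp hcon).and_eventually hev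
      have hlim : Tendsto (fun n => ‖μ • v - Φn n v‖) atTop (𝓝 0) := by
        have := ((hΦlim v).const_sub (μ • v)).norm
        rwa [hvΦ, sub_self, norm_zero] at this
      have hle : c * ‖v‖ ≤ 0 := by
        refine ge_of_tendsto_of_frequently hlim (hfreq.mono ?_)
        rintro n ⟨hn1, hn2⟩
        push Not at hn1
        have hres : ∀ z ∈ Metric.closedBall μ r, z ∈ resolventSet ℂ (Φn n) := by
          intro z hz
          by_contra hz'
          have := hn1 z hz'
          rw [Metric.mem_closedBall, dist_comm] at hz
          exact absurd (hz.trans (min_le_left _ _)) (not_le.mpr this)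
        have hdiff : DiffContOnCl ℂ (resolvent (Φn n)) (Metric.ball μ r) := by
          refine DifferentiableOn.diffContOnCl fun z hz => ?_
          rw [closure_ball _ hr0.ne'] at hz
          exact (spectrum.hasDerivAt_resolvent_const_left
            (hres z hz)).differentiableAt.differentiableWithinAt
        have happly : ∀ z ∈ Metric.closedBall μ r, ∀ x,
            z • resolvent (Φn n) z x - Φn n (resolvent (Φn n) z x) = x := by
          intro z hz x
          have h1 : (algebraMap ℂ (E →L[ℂ] E) z - Φn n) * resolvent (Φn n) z = 1 :=
            Ring.mul_inverse_cancel _ (spectrum.mem_resolventSet_iff.mp (hres z hz))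
          have h2 := congrArg (fun T : E →L[ℂ] E => T x) h1
          simpa [Algebra.algebraMap_eq_smul_one] using h2
        have hsph : ∀ z ∈ frontier (Metric.ball μ r), ‖resolvent (Φn n) z‖ ≤ 1 / c := by
          intro z hz
          rw [frontier_ball _ hr0.ne'] at hz
          refine ContinuousLinearMap.opNorm_le_bound _ (by positivity) fun x => ?_
          have := hn2 z hz (resolvent (Φn n) z x)
          rw [happly z (Metric.sphere_subset_closedBall hz)] at this
          rw [one_div, ← div_eq_inv_mul, le_div_iff₀' hc]
          exact this
        -- Maximum principle for the operator-valued resolvent, holomorphic on a disc free of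
        -- spectrum.
        have hcen : ‖resolvent (Φn n) μ‖ ≤ 1 / c :=
          Complex.norm_le_of_forall_mem_frontier_norm_le Metric.isBounded_ball hdiff hsph
            (subset_closure (Metric.mem_ball_self hr0))
        have hinv : resolvent (Φn n) μ (μ • v - Φn n v) = v := by
          have h1 : resolvent (Φn n) μ * (algebraMap ℂ (E →L[ℂ] E) μ - Φn n) = 1 :=
            Ring.inverse_mul_cancel _ (spectrum.mem_resolventSet_iff.mp
              (hres μ (Metric.mem_closedBall_self hr0.le)))
          have h2 := congrArg (fun T : E →L[ℂ] E => T v) h1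
          simpa [Algebra.algebraMap_eq_smul_one] using h2
        have h3 := (resolvent (Φn n) μ).le_of_opNorm_le hcen (μ • v - Φn n v)
        rw [hinv, one_div, ← div_eq_inv_mul, le_div_iff₀' hc] at h3
        exact h3
      exact absurd hle (not_le.mpr (mul_pos hc (norm_pos_iff.mpr hv.2)))
    -- The spectral points nearest to `μ` converge to `μ`, which is more than accumulation.
    choose l hl hl' using fun n => (spectrum.isCompact (𝕜 := ℂ) (Φn n)).exists_infDist_eq_dist
      (spectrum.nonempty (Φn n)) μ
    refine ⟨l, fun n _ => hl n, Tendsto.mapClusterPt ?_⟩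
    rw [Metric.tendsto_nhds]
    intro ε hε
    filter_upwards [hnear (ε / 2) (by positivity)] with n hn
    obtain ⟨z, hz, hzd⟩ := hn
    rw [dist_comm, ← hl' n]
    exact ((Metric.infDist_le_dist_of_mem hz).trans hzd).trans_lt (by linarith)
  · rintro ⟨l, hl, hcl⟩
    have hmem : μ ∈ spectrum ℂ Φ := by
      by_contra hnot
      have hnear : ∀ᶠ w in 𝓝 μ, w ∉ spectrum ℂ Φ :=
        (spectrum.isClosed Φ).isOpen_compl.mem_nhds hnot
      obtain ⟨δ, hδ, hball⟩ := Metric.eventually_nhds_iff.mp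
        (hnear.and (hS.isOpen_compl.mem_nhds hμ))
      have hsub : ∀ z ∈ Metric.closedBall μ (δ / 2), z ∉ spectrum ℂ Φ ∧ z ∉ S := fun z hz =>
        hball ((Metric.mem_closedBall.mp hz).trans_lt (by linarith))
      obtain ⟨c, hc, hev⟩ := hbound (Metric.closedBall μ (δ / 2)) (isCompact_closedBall _ _)
        (fun z hz => (hsub z hz).2) (fun z hz => (hsub z hz).1)
      have hfr := hcl.frequently (Metric.closedBall_mem_nhds μ (half_pos hδ))
      obtain ⟨n, hn1, hn2, hn3⟩ := (hfr.and_eventually (hev.and (eventually_ge_atTop 1))).exists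
      have hsp := hl n hn3
      rw [hΦn n] at hsp
      have hev' := hasEigenvalue_add_compact (hMZ (Zn n))
        (fun h => (hsub _ hn1).2 (hΨn n h)) hsp
      rw [← hΦn n] at hev'
      obtain ⟨v, hv⟩ := hev'.exists_hasEigenvector
      have hv1 : Φn n v = l n • v := hv.apply_eq_smul
      have := hn2 _ hn1 v
      rw [hv1, sub_self, norm_zero] at this
      exact absurd this (not_le.mpr (mul_pos hc (norm_pos_iff.mpr hv.2)))
    rw [hΦ] at hmem ⊢
    exact hasEigenvalue_add_compact (hMZ Z) (fun h => hμ (hΨ h)) hmem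

end Approximation

/-! ### Estimates for time maps -/

section TimeMapEstimates

open Filter Topology

variable {E : Type*} [NormedAddCommGroup E] [NormedSpace ℂ E]

theorem norm_le_gronwallBound_of_hasDerivAt {y y' : ℝ → E} {C ε T : ℝ}
    (hy : ∀ t, HasDerivAt y (y' t) t)
    (hb : ∀ t ∈ Set.Icc 0 T, ‖y' t‖ ≤ C * ‖y t‖ + ε) {t : ℝ} (ht : t ∈ Set.Icc 0 T) :
    ‖y t‖ ≤ gronwallBound ‖y 0‖ C ε t := by
  have := norm_le_gronwallBound_of_norm_deriv_right_le (f := y) (f' := y') (δ := ‖y 0‖) (K := C)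
    (ε := ε) (a := 0) (b := T) (fun s _ => (hy s).continuousAt.continuousWithinAt)
    (fun s _ => (hy s).hasDerivWithinAt) le_rfl (fun s hs => hb s ⟨hs.1, hs.2.le⟩) t ht
  simpa using this

/-- Strong convergence of a bounded family is uniform on compact sets. It is applied to compact
pieces of a trajectory, to get uniformity in time. -/
theorem eventually_forall_norm_le_of_isCompact {F : Type*} [NormedAddCommGroup F]
    [NormedSpace ℂ F] {T : ℕ → E →L[ℂ] F} {C : ℝ}
    (hT : ∀ n, ‖T n‖ ≤ C) (hlim : ∀ v, Tendsto (fun n => T n v) atTop (𝓝 0)) {S : Set E}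
    (hS : IsCompact S) {ε : ℝ} (hε : 0 < ε) : ∀ᶠ n in atTop, ∀ v ∈ S, ‖T n v‖ ≤ ε := by
  have hC : 0 ≤ C := (norm_nonneg _).trans (hT 0)
  obtain ⟨t, -, ht, hcov⟩ := hS.finite_cover_balls (show 0 < ε / (2 * (C + 1)) by positivity)
  have h1 : ∀ᶠ n in atTop, ∀ v ∈ t, ‖T n v‖ < ε / 2 := by
    rw [Filter.eventually_all_finite ht]
    intro v _
    have := (hlim v).norm
    rw [norm_zero] at this
    exact this.eventually_lt_const (by positivity)
  filter_upwards [h1] with n hn v hv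
  obtain ⟨w, hw, hvw⟩ := Set.mem_iUnion₂.mp (hcov hv)
  have h2 : ‖T n (v - w)‖ ≤ ε / 2 := by
    refine ((T n).le_opNorm _).trans ?_
    rw [Metric.mem_ball, dist_eq_norm] at hvw
    calc ‖T n‖ * ‖v - w‖ ≤ (C + 1) * (ε / (2 * (C + 1))) := by
          gcongr
          exact (hT n).trans (by linarith)
      _ = ε / 2 := by
          have : C + 1 ≠ 0 := by positivity
          field_simp
  calc ‖T n v‖ = ‖T n (v - w) + T n w‖ := by rw [← map_add, sub_add_cancel]
    _ ≤ ε / 2 + ε / 2 := (norm_add_le _ _).trans (add_le_add h2 (hn w hw).le)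
    _ = ε := by ring

variable [CompleteSpace E]

theorem norm_timeMap_le {A : ℝ → E →L[ℂ] E} (hA : Continuous A) {C T : ℝ}
    (hC : ∀ t ∈ Set.Icc 0 T, ‖A t‖ ≤ C) {t : ℝ} (ht : t ∈ Set.Icc 0 T) :
    ‖timeMap A hA t‖ ≤ Real.exp (C * t) := by
  refine ContinuousLinearMap.opNorm_le_bound _ (Real.exp_pos _).le fun v => ?_
  have := norm_le_gronwallBound_of_hasDerivAt (C := C) (ε := 0) (T := T)
    (timeMap_apply_hasDerivAt A hA v)
    (fun s hs => by
      rw [add_zero]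
      exact (A s).le_of_opNorm_le (hC s hs) _) ht
  rw [gronwallBound_ε0, timeMap_zero] at this
  rw [mul_comm]
  simpa using this

theorem continuous_timeMap (A : ℝ → E →L[ℂ] E) (hA : Continuous A) : Continuous (timeMap A hA) :=
  continuous_iff_continuousAt.mpr fun t => (timeMap_hasDerivAt A hA t).continuousAt

theorem timeMap_const (X : E →L[ℂ] E) (t : ℝ) :
    timeMap (fun _ => X) continuous_const t = NormedSpace.exp (t • X) := by
  ext v
  have := timeMap_eq (fun _ => X) continuous_const (fun s => NormedSpace.exp (s • X) v)
    (fun s => by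
      let ev : (E →L[ℂ] E) →L[ℝ] E := (ContinuousLinearMap.apply ℂ E v).restrictScalars ℝ
      exact ev.hasFDerivAt.comp_hasDerivAt s (hasDerivAt_exp_smul_const' X s)) t
  simpa using this.symm

/-- The reversed trajectory `s ↦ Φ(T - s) v` solves the equation with coefficient `-A (T - s)` and
ends at `v`. -/
theorem timeMap_reverse_mul (A : ℝ → E →L[ℂ] E) (hA : Continuous A) (T : ℝ)
    (hB : Continuous fun s => -A (T - s)) :
    timeMap (fun s => -A (T - s)) hB T * timeMap A hA T = 1 := by
  ext v
  have := timeMap_eq (fun s => -A (T - s)) hB (fun s => timeMap A hA (T - s) v) (fun s => by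
    simpa using (timeMap_apply_hasDerivAt A hA v (T - s)).comp_const_sub T s) T
  simpa [timeMap_zero] using this.symm

theorem isUnit_timeMap (A : ℝ → E →L[ℂ] E) (hA : Continuous A) (T : ℝ) :
    IsUnit (timeMap A hA T) := by
  have hB : Continuous fun s => -A (T - s) := by fun_prop
  have h1 := timeMap_reverse_mul A hA T hB
  have h2 := timeMap_reverse_mul (fun s => -A (T - s)) hB T (by simpa using hA)
  simp only [neg_neg, sub_sub_cancel] at h2
  exact ⟨⟨_, _, h2, h1⟩, rfl⟩

/-- Duhamel's formula: integrate the derivative of `exp ((T - s) X) Φ(s)` from `0` to `T`. -/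
theorem timeMap_sub_exp (A : ℝ → E →L[ℂ] E) (hA : Continuous A) (X : E →L[ℂ] E) (T : ℝ) :
    timeMap A hA T - NormedSpace.exp (T • X) =
      ∫ s in (0 : ℝ)..T, NormedSpace.exp ((T - s) • X) * ((A s - X) * timeMap A hA s) := by
  have hexp : ∀ s, HasDerivAt (fun s : ℝ => NormedSpace.exp ((T - s) • X))
      (-(NormedSpace.exp ((T - s) • X) * X)) s := fun s =>
    (hasDerivAt_exp_smul_const X (T - s)).comp_const_sub T s
  have hd : ∀ s, HasDerivAt (fun s : ℝ => NormedSpace.exp ((T - s) • X) * timeMap A hA s)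
      (NormedSpace.exp ((T - s) • X) * ((A s - X) * timeMap A hA s)) s := fun s => by
    refine ((hexp s).mul (timeMap_hasDerivAt A hA s)).congr_deriv ?_
    change _ + _ * (A s * timeMap A hA s) = _
    noncomm_ring
  have hc : Continuous fun s : ℝ => NormedSpace.exp ((T - s) • X) :=
    continuous_iff_continuousAt.mpr fun s => (hexp s).continuousAt
  rw [intervalIntegral.integral_eq_sub_of_hasDerivAt (fun s _ => hd s)]
  · simp [timeMap_zero]
  · exact (hc.mul ((hA.sub continuous_const).mul (continuous_timeMap A hA))).intervalIntegrable _ _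

theorem norm_exp_smul_le (X : E →L[ℂ] E) {C T t : ℝ} (hC : ‖X‖ ≤ C) (ht : t ∈ Set.Icc 0 T) :
    ‖NormedSpace.exp (t • X)‖ ≤ Real.exp (C * T) := by
  rw [← timeMap_const]
  refine (norm_timeMap_le continuous_const (fun _ _ => hC) ht).trans ?_
  have : 0 ≤ C := (norm_nonneg _).trans hC
  gcongr
  exact ht.2

/-- If a perturbation of a constant generator `X` factors through `M`, and `M` intertwines `X` with
a bounded operator, then the perturbation of the time map factors through `M`. -/
theorem exists_timeMap_eq_add_mul {A : ℝ → E →L[ℂ] E} (hA : Continuous A)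
    {X X' M : E →L[ℂ] E} {W : ℝ → E →L[ℂ] E} (hW : Continuous W) (hX : X * M = M * X')
    (hAW : ∀ s, A s = X + M * W s) {T c₁ c₂ c₃ : ℝ} (hT : 0 ≤ T) (h₁ : ‖X'‖ ≤ c₁)
    (h₂ : ∀ s, ‖W s‖ ≤ c₂) (h₃ : ∀ s, ‖A s‖ ≤ c₃) :
    ∃ Z : E →L[ℂ] E, timeMap A hA T = timeMap (fun _ => X) continuous_const T + M * Z ∧
      ‖Z‖ ≤ Real.exp (c₁ * T) * (c₂ * Real.exp (c₃ * T)) * T := by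
  have hexp : ∀ s : ℝ, NormedSpace.exp (s • X) * M = M * NormedSpace.exp (s • X') := fun s => by
    let _ : NormedAlgebra ℚ (E →L[ℂ] E) := NormedAlgebra.restrictScalars ℚ ℝ _
    have : SemiconjBy M (s • X') (s • X) := by
      rw [SemiconjBy, mul_smul_comm, smul_mul_assoc, hX]
    exact (this.exp_right).symm
  have hc : Continuous fun s : ℝ => NormedSpace.exp ((T - s) • X') := by
    have : Continuous fun s : ℝ => NormedSpace.exp (s • X') :=
      continuous_iff_continuousAt.mpr fun s => (hasDerivAt_exp_smul_const X' s).continuousAt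
    exact this.comp (continuous_const.sub continuous_id)
  have hci : Continuous fun s : ℝ =>
      NormedSpace.exp ((T - s) • X') * (W s * timeMap A hA s) :=
    hc.mul (hW.mul (continuous_timeMap A hA))
  -- This is the Duhamel integral after `M` has been moved to the left through `exp ((T - s) X)`,
  -- which turns `X` into `X'`.
  refine ⟨∫ s in (0 : ℝ)..T, NormedSpace.exp ((T - s) • X') * (W s * timeMap A hA s), ?_, ?_⟩
  · rw [timeMap_const, ← sub_eq_iff_eq_add', timeMap_sub_exp A hA X T]
    have : ∀ s, NormedSpace.exp ((T - s) • X) * ((A s - X) * timeMap A hA s) =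
        ContinuousLinearMap.mul ℝ (E →L[ℂ] E) M
          (NormedSpace.exp ((T - s) • X') * (W s * timeMap A hA s)) := fun s => by
      rw [hAW s, add_sub_cancel_left, ContinuousLinearMap.mul_apply', mul_assoc, ← mul_assoc,
        hexp, mul_assoc]
    simp_rw [this]
    rw [ContinuousLinearMap.intervalIntegral_comp_comm _ (hci.intervalIntegrable _ _)]
    rfl
  · have := intervalIntegral.norm_integral_le_of_norm_le_const (a := 0) (b := T)
      (C := Real.exp (c₁ * T) * (c₂ * Real.exp (c₃ * T)))
      (f := fun s => NormedSpace.exp ((T - s) • X') * (W s * timeMap A hA s)) (fun s hs => by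
        rw [Set.uIoc_of_le hT] at hs
        have hc3 : 0 ≤ c₃ := (norm_nonneg _).trans (h₃ 0)
        have hc2 : 0 ≤ c₂ := (norm_nonneg _).trans (h₂ 0)
        refine (norm_mul_le _ _).trans (mul_le_mul
          (norm_exp_smul_le X' h₁ ⟨by linarith [hs.2], by linarith [hs.1]⟩) ?_
          (norm_nonneg _) (Real.exp_pos _).le)
        refine (norm_mul_le _ _).trans (mul_le_mul (h₂ s) ?_ (norm_nonneg _) hc2)
        refine (norm_timeMap_le hA (T := T) (fun t _ => h₃ t) ⟨hs.1.le, hs.2⟩).trans ?_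
        gcongr
        exact hs.2)
    simpa [abs_of_nonneg hT] using this

/-- The difference of trajectories solves the `An`-equation with zero initial value and forcing `(An
- A) Φ(t) v`. The forcing is evaluated on the limit trajectory, so strong convergence of generators
suffices for Grönwall. -/
theorem tendsto_timeMap_apply {An : ℕ → ℝ → E →L[ℂ] E} (hAn : ∀ n, Continuous (An n))
    {A : ℝ → E →L[ℂ] E} (hA : Continuous A) {C T : ℝ} (hT : 0 ≤ T) (hC : ∀ n t, ‖An n t‖ ≤ C)
    (v : E)
    (h : ∀ ε > 0, ∀ᶠ n in atTop, ∀ t ∈ Set.Icc 0 T, ‖(An n t - A t) (timeMap A hA t v)‖ ≤ ε) :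
    Tendsto (fun n => timeMap (An n) (hAn n) T v) atTop (𝓝 (timeMap A hA T v)) := by
  rw [tendsto_iff_norm_sub_tendsto_zero, Metric.tendsto_nhds]
  intro ε hε
  have hg : Tendsto (fun δ => gronwallBound 0 C δ T) (𝓝[>] 0) (𝓝 0) := by
    have := (gronwallBound_continuous_ε 0 C T).tendsto 0
    rw [gronwallBound_ε0_δ0] at this
    exact this.mono_left nhdsWithin_le_nhds
  obtain ⟨δ, hδ, hδ0⟩ := ((hg.eventually_lt_const hε).and self_mem_nhdsWithin).exists
  filter_upwards [h δ hδ0] with n hn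
  have := norm_le_gronwallBound_of_hasDerivAt (C := C) (ε := δ) (T := T) (t := T)
    (fun t => (timeMap_apply_hasDerivAt (An n) (hAn n) v t).fun_sub
      (timeMap_apply_hasDerivAt A hA v t))
    (fun t ht => by
      have h1 : An n t (timeMap (An n) (hAn n) t v) - A t (timeMap A hA t v) =
          An n t (timeMap (An n) (hAn n) t v - timeMap A hA t v) +
            (An n t - A t) (timeMap A hA t v) := by
        rw [map_sub, sub_apply]; abel
      rw [h1]
      refine (norm_add_le _ _).trans (add_le_add ?_ (hn t ht))
      exact (An n t).le_of_opNorm_le (hC n t) _) ⟨hT, le_rfl⟩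
  simp only [timeMap_zero, sub_self, norm_zero] at this
  simpa using this.trans_lt hδ

end TimeMapEstimates

/-! ### The spectrum of the free flow -/

section FreeSpectrum

/-- A continuous square root on the real line. -/
noncomputable def rootCurve (x : ℝ) : ℂ := (√x : ℂ) + √(-x) * Complex.I

theorem continuous_rootCurve : Continuous rootCurve := by
  unfold rootCurve
  fun_prop

theorem rootCurve_cases (x : ℝ) :
    rootCurve x = (√x : ℂ) ∨ rootCurve x = √(-x) * Complex.I := by
  rcases le_total 0 x with h | h
  · left; simp [rootCurve, Real.sqrt_eq_zero_of_nonpos (neg_nonpos.mpr h)]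
  · right; simp [rootCurve, Real.sqrt_eq_zero_of_nonpos h]

theorem rootCurve_sq (x : ℝ) : rootCurve x ^ 2 = x := by
  rcases le_total 0 x with h | h
  · simp only [rootCurve, Real.sqrt_eq_zero_of_nonpos (neg_nonpos.mpr h), Complex.ofReal_zero,
      zero_mul, add_zero]
    rw [← Complex.ofReal_pow, Real.sq_sqrt h]
  · simp only [rootCurve, Real.sqrt_eq_zero_of_nonpos h, Complex.ofReal_zero, zero_add]
    rw [mul_pow, ← Complex.ofReal_pow, Real.sq_sqrt (by linarith), Complex.I_sq]
    push_cast; ring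

/-- A square root of `-(ᾱ x + β̄)`. -/
noncomputable def freeExponent (αbar βbar x : ℝ) : ℂ := rootCurve (-(αbar * x + βbar))

theorem continuous_freeExponent (αbar βbar : ℝ) : Continuous (freeExponent αbar βbar) :=
  continuous_rootCurve.comp (by fun_prop)

theorem freeExponent_sq (αbar βbar x : ℝ) :
    freeExponent αbar βbar x ^ 2 = -((αbar : ℂ) * x + βbar) := by
  rw [freeExponent, rootCurve_sq]; push_cast; ring

/-- With `x = 2 (1 - cos φ)` running over `[0, 4]`, the two signs of the square root give two
continuous images of a compact interval. -/
theorem essSpec_eq (αbar βbar : ℝ) : essSpec αbar βbar =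
    (fun x => Complex.exp (2 * Real.pi * freeExponent αbar βbar x)) '' Set.Icc 0 4 ∪
    (fun x => Complex.exp (-(2 * Real.pi * freeExponent αbar βbar x))) '' Set.Icc 0 4 := by
  have hmem : ∀ (z : ℂ) (x : ℝ), x ∈ Set.Icc 0 4 → z ^ 2 = freeExponent αbar βbar x ^ 2 →
      Complex.exp (2 * Real.pi * z) ∈ essSpec αbar βbar := by
    intro z x hx hz
    refine ⟨z, ⟨Real.arccos (1 - x / 2), ?_⟩, rfl⟩
    simp only [symbol]
    rw [hz, freeExponent_sq, Real.cos_arccos (by linarith [hx.2]) (by linarith [hx.1])]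
    push_cast; ring
  apply Set.Subset.antisymm
  · rintro _ ⟨z, ⟨φ, hφ⟩, rfl⟩
    have hx : 2 * (1 - Real.cos φ) ∈ Set.Icc (0 : ℝ) 4 :=
      ⟨by linarith [Real.cos_le_one φ], by linarith [Real.neg_one_le_cos φ]⟩
    have hz : z ^ 2 = freeExponent αbar βbar (2 * (1 - Real.cos φ)) ^ 2 := by
      rw [freeExponent_sq, ← neg_eq_iff_eq_neg, ← hφ]
      simp only [symbol]
      push_cast; ring
    rcases sq_eq_sq_iff_eq_or_eq_neg.mp hz with h | h
    · exact Or.inl ⟨_, hx, by simp only [h]⟩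
    · exact Or.inr ⟨_, hx, by simp [h]⟩
  · rintro _ (⟨x, hx, rfl⟩ | ⟨x, hx, rfl⟩)
    · exact hmem _ x hx rfl
    · have := hmem (-freeExponent αbar βbar x) x hx (by ring)
      rwa [mul_neg] at this

theorem isClosed_essSpec (αbar βbar : ℝ) : IsClosed (essSpec αbar βbar) := by
  rw [essSpec_eq]
  have hc := continuous_freeExponent αbar βbar
  exact ((isCompact_Icc.image (by fun_prop)).union
    (isCompact_Icc.image (by fun_prop))).isClosed

/-- The exponent is a square root of a real number, hence real or purely imaginary. -/
theorem norm_eq_one_or_im_eq_zero_of_mem_essSpec {αbar βbar : ℝ} {z : ℂ}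
    (hz : z ∈ essSpec αbar βbar) : ‖z‖ = 1 ∨ z.im = 0 := by
  have key : ∀ (s x : ℝ), ‖Complex.exp (s * rootCurve x)‖ = 1 ∨
      (Complex.exp (s * rootCurve x)).im = 0 := by
    intro s x
    rcases rootCurve_cases x with h | h
    · right
      rw [h, ← Complex.ofReal_mul]
      exact Complex.exp_ofReal_im _
    · left
      rw [h, ← mul_assoc, ← Complex.ofReal_mul]
      exact Complex.norm_exp_ofReal_mul_I _
  rw [essSpec_eq] at hz
  rcases hz with ⟨x, -, rfl⟩ | ⟨x, -, rfl⟩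
  · simpa [freeExponent] using key (2 * Real.pi) (-(αbar * x + βbar))
  · simpa [freeExponent] using key (-(2 * Real.pi)) (-(αbar * x + βbar))

/-- Only even powers survive in the series. This lets a generator that need not be normal be
replaced by a normal one with the same square. -/
theorem exp_add_exp_neg_eq_of_mul_self_eq {R : Type*} [NormedRing R] [NormedAlgebra ℂ R]
    [CompleteSpace R] {X Y : R} (h : X * X = Y * Y) :
    NormedSpace.exp X + NormedSpace.exp (-X) = NormedSpace.exp Y + NormedSpace.exp (-Y) := by
  have hs : ∀ Z : R, HasSum (fun n : ℕ => ((n.factorial : ℂ)⁻¹) • Z ^ n) (NormedSpace.exp Z) :=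
    fun Z => NormedSpace.exp_series_hasSum_exp' Z
  refine ((hs X).add (hs (-X))).unique ?_
  convert (hs Y).add (hs (-Y)) using 2 with n
  rw [← smul_add, ← smul_add]
  congr 1
  rcases Nat.even_or_odd n with hn | hn
  · rw [hn.neg_pow, hn.neg_pow]
    obtain ⟨k, rfl⟩ := hn
    have hp : ∀ Z : R, Z ^ (k + k) = (Z * Z) ^ k := fun Z => by
      rw [← sq, ← pow_mul, two_mul]
    rw [hp, hp, h]
  · rw [hn.neg_pow, hn.neg_pow, add_neg_cancel, add_neg_cancel]

section CStar

variable {R : Type*} [CStarAlgebra R]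

theorem exists_inverse_algebraMap_sub_cfc {A : R} (hA : IsStarNormal A) {z : ℂ} {δ : ℝ}
    (hδ : 0 < δ) {s : ℂ → ℂ} (hs : Continuous s) (hδs : ∀ w ∈ spectrum ℂ A, δ ≤ ‖z - s w‖) :
    ∃ L : R, L * (algebraMap ℂ R z - cfc s A) = 1 ∧ (algebraMap ℂ R z - cfc s A) * L = 1 ∧
      ‖L‖ ≤ δ⁻¹ := by
  have h0 : ∀ w ∈ spectrum ℂ A, z - s w ≠ 0 := fun w hw h => by
    have := hδs w hw
    rw [h, norm_zero] at this
    linarith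
  have hcs : ContinuousOn (fun w => z - s w) (spectrum ℂ A) := by fun_prop
  have hci : ContinuousOn (fun w => (z - s w)⁻¹) (spectrum ℂ A) := hcs.inv₀ h0
  have he : algebraMap ℂ R z - cfc s A = cfc (fun w => z - s w) A := by
    rw [cfc_sub (fun _ => z) s A, cfc_const z A]
  rw [he]
  refine ⟨cfc (fun w => (z - s w)⁻¹) A, ?_, ?_, ?_⟩
  · rw [← cfc_mul (fun w => (z - s w)⁻¹) (fun w => z - s w) A hci hcs, ← cfc_const_one ℂ A]
    exact cfc_congr fun w hw => inv_mul_cancel₀ (h0 w hw)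
  · rw [← cfc_mul (fun w => z - s w) (fun w => (z - s w)⁻¹) A hcs hci, ← cfc_const_one ℂ A]
    exact cfc_congr fun w hw => mul_inv_cancel₀ (h0 w hw)
  · refine norm_cfc_le (by positivity) fun w hw => ?_
    rw [norm_inv]
    exact inv_anti₀ hδ (hδs w hw)

theorem exp_mul_exp_neg (Y : R) : NormedSpace.exp Y * NormedSpace.exp (-Y) = 1 := by
  let _ : NormedAlgebra ℚ R := NormedAlgebra.restrictScalars ℚ ℂ _
  rw [← NormedSpace.exp_add_of_commute (Commute.neg_right (Commute.refl Y)), add_neg_cancel,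
    NormedSpace.exp_zero]

theorem algebraMap_sub_exp_mul (z : ℂ) (Y : R) :
    (algebraMap ℂ R z - NormedSpace.exp Y) * (algebraMap ℂ R z - NormedSpace.exp (-Y)) =
      algebraMap ℂ R z * algebraMap ℂ R z + 1 -
        algebraMap ℂ R z * (NormedSpace.exp Y + NormedSpace.exp (-Y)) := by
  rw [sub_mul, mul_sub, mul_sub, exp_mul_exp_neg, ← Algebra.commutes z (NormedSpace.exp Y), mul_add]
  abel

/-- For a square root `X` of `-(ᾱ A + β̄)`, `0 ≤ A ≤ 4`, the product
`(z - exp(-2πX)) (z - exp(2πX))` is a function of `A`, invertible off the essential spectrum. -/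
theorem exists_inverse_of_mul_self_eq {αbar βbar : ℝ} {z : ℂ} {δ : ℝ}
    (hδ : 0 < δ) (hz : ∀ w ∈ essSpec αbar βbar, δ ≤ ‖z - w‖) {X A : R} (hA : IsStarNormal A)
    (hspec : ∀ w ∈ spectrum ℂ A, ∃ x ∈ Set.Icc (0 : ℝ) 4, w = x)
    (hX : X * X = ((2 * Real.pi) ^ 2 : ℂ) • -((αbar : ℂ) • A + (βbar : ℂ) • 1)) :
    ∃ L : R, L * ((algebraMap ℂ R z - NormedSpace.exp (-X)) *
        (algebraMap ℂ R z - NormedSpace.exp X)) = 1 ∧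
      ((algebraMap ℂ R z - NormedSpace.exp X) *
        (algebraMap ℂ R z - NormedSpace.exp (-X))) * L = 1 ∧ ‖L‖ ≤ δ⁻¹ * δ⁻¹ := by
  -- The real part extends the exponent to a continuous function on `ℂ`; the spectrum of `A` is
  -- real, so nothing changes there.
  set r : ℂ → ℂ := fun w => 2 * Real.pi * freeExponent αbar βbar w.re with hr
  have hrc : Continuous r := by
    have := continuous_freeExponent αbar βbar
    fun_prop
  set B := cfc r A with hB
  have hBB : X * X = B * B := by
    have h1 : B * B = cfc (fun w => ((2 * Real.pi) ^ 2 : ℂ) * -((αbar : ℂ) * w + βbar)) A := by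
      rw [hB, ← cfc_mul r r A]
      refine cfc_congr fun w hw => ?_
      obtain ⟨x, -, rfl⟩ := hspec w hw
      have := freeExponent_sq αbar βbar x
      simp only [hr, Complex.ofReal_re]
      rw [← this]; ring
    rw [h1, hX, cfc_const_mul ((2 * Real.pi) ^ 2 : ℂ) (fun w => -((αbar : ℂ) * w + βbar)) A,
      cfc_neg (fun w => (αbar : ℂ) * w + βbar) A,
      cfc_add A (fun w => (αbar : ℂ) * w) (fun _ => (βbar : ℂ)), cfc_const_mul_id (αbar : ℂ) A,
      cfc_const (βbar : ℂ) A, Algebra.algebraMap_eq_smul_one]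
  have hexpB : NormedSpace.exp B = cfc (fun w => Complex.exp (r w)) A := by
    rw [hB, ← CFC.complex_exp_eq_normedSpace_exp (cfc_predicate r A)]
    exact (cfc_comp' Complex.exp r A).symm
  have hexpB' : NormedSpace.exp (-B) = cfc (fun w => Complex.exp (-r w)) A := by
    rw [hB, ← cfc_neg r A, ← CFC.complex_exp_eq_normedSpace_exp (cfc_predicate _ A)]
    exact (cfc_comp' Complex.exp (fun w => -r w) A).symm
  obtain ⟨L₁, hl1, hr1, hn1⟩ := exists_inverse_algebraMap_sub_cfc hA hδ
    (s := fun w => Complex.exp (r w)) (by fun_prop) fun w hw => by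
    obtain ⟨x, hx, rfl⟩ := hspec w hw
    refine hz _ ?_
    rw [essSpec_eq]
    exact Or.inl ⟨x, hx, by simp [hr]⟩
  obtain ⟨L₂, hl2, hr2, hn2⟩ := exists_inverse_algebraMap_sub_cfc hA hδ
    (s := fun w => Complex.exp (-r w)) (by fun_prop) fun w hw => by
    obtain ⟨x, hx, rfl⟩ := hspec w hw
    refine hz _ ?_
    rw [essSpec_eq]
    exact Or.inr ⟨x, hx, by simp [hr]⟩
  rw [← hexpB] at hl1 hr1
  rw [← hexpB'] at hl2 hr2
  have hcosh := exp_add_exp_neg_eq_of_mul_self_eq hBB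
  have hprod := algebraMap_sub_exp_mul z X
  rw [hcosh, ← algebraMap_sub_exp_mul z B] at hprod
  have hprod' := algebraMap_sub_exp_mul z (-X)
  rw [neg_neg, add_comm (NormedSpace.exp (-X)), hcosh, ← algebraMap_sub_exp_mul z B] at hprod'
  -- The products taken in either order yield a left and a right inverse of `z - exp X`.
  refine ⟨L₂ * L₁, ?_, ?_, (norm_mul_le _ _).trans (by gcongr)⟩
  · rw [hprod', mul_assoc, ← mul_assoc L₁, hl1, one_mul, hl2]
  · rw [hprod, mul_assoc, ← mul_assoc _ L₂, hr2, one_mul, hr1]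

end CStar

variable {E : Type*} [NormedAddCommGroup E] [InnerProductSpace ℂ E] [CompleteSpace E]

theorem exists_eq_ofReal_of_mem_spectrum_star_mul_self [Nontrivial E] {G : E →L[ℂ] E} (hG : ‖G‖ ≤ 2)
    {z : ℂ} (hz : z ∈ spectrum ℂ (star G * G)) : ∃ x ∈ Set.Icc (0 : ℝ) 4, z = x := by
  have hsa : IsSelfAdjoint (star G * G) := IsSelfAdjoint.star_mul_self G
  have hre : z = z.re := hsa.mem_spectrum_eq_re hz
  have h4 : ‖star G * G‖ ≤ 4 := by
    rw [CStarRing.norm_star_mul_self]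
    nlinarith [norm_nonneg G]
  refine ⟨z.re, ⟨?_, ?_⟩, hre⟩
  · apply spectrum_star_mul_self_nonneg (b := G)
    rw [hre] at hz
    exact (spectrum.algebraMap_mem_iff ℂ).mp hz
  · exact (Complex.re_le_norm z).trans ((spectrum.norm_le_norm_of_mem hz).trans h4)

/-- Invertibility of `z - Φ(2π)` for `Φ' = X Φ` off the essential spectrum for a square root `X` of
`-(ᾱ G*G + β̄)`, `‖G‖ ≤ 2`, with a bound for the inverse that depends on `‖X‖` only. -/
theorem exists_resolvent_bound_of_mul_self_eq [Nontrivial E] {αbar βbar : ℝ} {z : ℂ} {δ : ℝ}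
    (hδ : 0 < δ) (hz : ∀ w ∈ essSpec αbar βbar, δ ≤ ‖z - w‖) {X G : E →L[ℂ] E} (hG : ‖G‖ ≤ 2)
    (hX : X * X = -((αbar : ℂ) • (star G * G) + (βbar : ℂ) • 1)) :
    IsUnit (algebraMap ℂ (E →L[ℂ] E) z - timeMap (fun _ => X) continuous_const (2 * Real.pi)) ∧
    ∀ C : ℝ, ‖X‖ ≤ C → ∀ x, δ ^ 2 / (‖z‖ + Real.exp (C * (2 * Real.pi))) * ‖x‖ ≤
      ‖z • x - timeMap (fun _ => X) continuous_const (2 * Real.pi) x‖ := by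
  rw [timeMap_const]
  set X' := (2 * Real.pi) • X with hX'
  have hXX : X' * X' = ((2 * Real.pi) ^ 2 : ℂ) •
      -((αbar : ℂ) • (star G * G) + (βbar : ℂ) • 1) := by
    rw [← hX, hX', smul_mul_smul_comm, ← sq, ← Complex.coe_smul]
    push_cast
    rfl
  obtain ⟨L, h1, h2, hn⟩ := exists_inverse_of_mul_self_eq hδ hz
    (IsSelfAdjoint.star_mul_self G).isStarNormal
    (fun w hw => exists_eq_ofReal_of_mem_spectrum_star_mul_self hG hw) hXX
  constructor
  · rw [← mul_assoc] at h1
    rw [mul_assoc] at h2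
    exact isUnit_iff_exists_and_exists.mpr ⟨⟨_, h2⟩, ⟨_, h1⟩⟩
  · intro C hC x
    have hN : ‖algebraMap ℂ (E →L[ℂ] E) z - NormedSpace.exp (-X')‖ ≤
        ‖z‖ + Real.exp (C * (2 * Real.pi)) := by
      refine (norm_sub_le _ _).trans (add_le_add (by simp) ?_)
      rw [hX', ← smul_neg]
      exact norm_exp_smul_le (-X) (by rwa [norm_neg]) ⟨by positivity, le_rfl⟩
    have h3 : ‖x‖ ≤ δ⁻¹ * δ⁻¹ * ((‖z‖ + Real.exp (C * (2 * Real.pi))) *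
        ‖z • x - NormedSpace.exp X' x‖) := by
      have h4 : x = L ((algebraMap ℂ (E →L[ℂ] E) z - NormedSpace.exp (-X'))
          (z • x - NormedSpace.exp X' x)) := by
        have h5 := congrArg (fun T : E →L[ℂ] E => T x) h1
        simp only [mul_apply_eq_comp, one_apply_eq_self] at h5
        conv_lhs => rw [← h5]
        congr 2
      conv_lhs => rw [h4]
      exact (L.le_of_opNorm_le hn _).trans
        (mul_le_mul_of_nonneg_left (ContinuousLinearMap.le_of_opNorm_le _ hN _) (by positivity))
    have hD : 0 < ‖z‖ + Real.exp (C * (2 * Real.pi)) := by positivity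
    rw [div_mul_eq_mul_div, div_le_iff₀' hD]
    calc δ ^ 2 * ‖x‖ ≤ δ ^ 2 * (δ⁻¹ * δ⁻¹ * ((‖z‖ + Real.exp (C * (2 * Real.pi))) *
        ‖z • x - NormedSpace.exp X' x‖)) := by gcongr
      _ = _ := by field_simp

end FreeSpectrum

/-! ### Block operators on phase space -/

section Blocks

/-- The operator `(v, ν) ↦ (T v, T ν)`. -/
noncomputable def diagOp (T : ℓ²(ℤ, ℂ) →L[ℂ] ℓ²(ℤ, ℂ)) : Phase →L[ℂ] Phase :=
  (WithLp.prodContinuousLinearEquiv 2 ℂ ℓ²(ℤ, ℂ) ℓ²(ℤ, ℂ)).symm.toContinuousLinearMap ∘L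
    ((T ∘L WithLp.fstL 2 ℂ ℓ²(ℤ, ℂ) ℓ²(ℤ, ℂ)).prod (T ∘L WithLp.sndL 2 ℂ ℓ²(ℤ, ℂ) ℓ²(ℤ, ℂ)))

theorem diagOp_toLp (T : ℓ²(ℤ, ℂ) →L[ℂ] ℓ²(ℤ, ℂ)) (v ν : ℓ²(ℤ, ℂ)) :
    diagOp T (WithLp.toLp 2 (v, ν)) = WithLp.toLp 2 (T v, T ν) := rfl

theorem phase_clm_ext {S T : Phase →L[ℂ] Phase}
    (h : ∀ v ν, S (WithLp.toLp 2 (v, ν)) = T (WithLp.toLp 2 (v, ν))) : S = T :=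
  ContinuousLinearMap.ext fun x => h x.fst x.snd

theorem norm_toLp_sq (v ν : ℓ²(ℤ, ℂ)) :
    ‖(WithLp.toLp 2 (v, ν) : Phase)‖ ^ 2 = ‖v‖ ^ 2 + ‖ν‖ ^ 2 :=
  WithLp.prod_norm_sq_eq_of_L2 _

theorem norm_diagOp_le (T : ℓ²(ℤ, ℂ) →L[ℂ] ℓ²(ℤ, ℂ)) : ‖diagOp T‖ ≤ ‖T‖ := by
  refine ContinuousLinearMap.opNorm_le_bound _ (norm_nonneg _) fun x => ?_
  refine le_of_sq_le_sq ?_ (by positivity)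
  have h1 := T.le_opNorm x.fst
  have h2 := T.le_opNorm x.snd
  have h3 : ‖diagOp T x‖ ^ 2 = ‖T x.fst‖ ^ 2 + ‖T x.snd‖ ^ 2 := norm_toLp_sq _ _
  rw [h3, mul_pow, WithLp.prod_norm_sq_eq_of_L2 x, mul_add, ← mul_pow, ← mul_pow]
  gcongr

theorem norm_vectorField_le (H : ℓ²(ℤ, ℂ) →L[ℂ] ℓ²(ℤ, ℂ)) : ‖vectorField H‖ ≤ 1 + ‖H‖ := by
  refine ContinuousLinearMap.opNorm_le_bound _ (by positivity) fun x => ?_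
  refine le_of_sq_le_sq ?_ (by positivity)
  have h1 : ‖vectorField H x‖ ^ 2 = ‖x.snd‖ ^ 2 + ‖-H x.fst‖ ^ 2 := norm_toLp_sq _ _
  have h2 : ‖H x.fst‖ ^ 2 ≤ (‖H‖ * ‖x.fst‖) ^ 2 := by gcongr; exact H.le_opNorm _
  rw [h1, norm_neg, mul_pow, WithLp.prod_norm_sq_eq_of_L2 x]
  nlinarith [norm_nonneg H, mul_nonneg (norm_nonneg H) (sq_nonneg ‖x.fst‖),
    mul_nonneg (norm_nonneg H) (sq_nonneg ‖x.snd‖), sq_nonneg ‖x.fst‖,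
    mul_nonneg (sq_nonneg ‖H‖) (sq_nonneg ‖x.snd‖)]

theorem star_diagOp (T : ℓ²(ℤ, ℂ) →L[ℂ] ℓ²(ℤ, ℂ)) : star (diagOp T) = diagOp (star T) := by
  rw [ContinuousLinearMap.star_eq_adjoint, ContinuousLinearMap.star_eq_adjoint]
  symm
  rw [ContinuousLinearMap.eq_adjoint_iff]
  intro x y
  rw [WithLp.prod_inner_apply, WithLp.prod_inner_apply]
  exact congrArg₂ (· + ·) (ContinuousLinearMap.adjoint_inner_left T y.fst x.fst)
    (ContinuousLinearMap.adjoint_inner_left T y.snd x.snd)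

theorem vectorField_mul_self (H : ℓ²(ℤ, ℂ) →L[ℂ] ℓ²(ℤ, ℂ)) :
    vectorField H * vectorField H = -diagOp H :=
  phase_clm_ext fun _ _ => rfl

theorem vectorField_mul_diagOp {H H' M : ℓ²(ℤ, ℂ) →L[ℂ] ℓ²(ℤ, ℂ)} (h : H * M = M * H') :
    vectorField H * diagOp M = diagOp M * vectorField H' :=
  phase_clm_ext fun v ν => by
    have h1 : H (M v) = M (H' v) := congrArg (fun T : ℓ²(ℤ, ℂ) →L[ℂ] ℓ²(ℤ, ℂ) => T v) h
    simp only [mul_apply_eq_comp, diagOp_toLp, vectorField_apply, h1, map_neg]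

/-- `vectorField` is affine in `H`; subtracting `vectorField 0` leaves its linear part. -/
theorem vectorField_add_mul (H M W : ℓ²(ℤ, ℂ) →L[ℂ] ℓ²(ℤ, ℂ)) :
    vectorField (H + M * W) = vectorField H + diagOp M * (vectorField W - vectorField 0) :=
  phase_clm_ext fun v ν => by
    simp only [add_apply, mul_apply_eq_comp, sub_apply, map_sub, diagOp_toLp, vectorField_apply]
    rw [← WithLp.toLp_sub, ← WithLp.toLp_add]
    simp [add_comm]

theorem vectorField_sub_toLp (H K : ℓ²(ℤ, ℂ) →L[ℂ] ℓ²(ℤ, ℂ)) (x : Phase) :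
    ‖(vectorField H - vectorField K) x‖ = ‖(H - K) x.fst‖ := by
  have h : (vectorField H - vectorField K) x = WithLp.toLp 2 (0, -((H - K) x.fst)) := by
    have h1 : (vectorField H - vectorField K) x =
      WithLp.toLp 2 (x.snd, -H x.fst) - WithLp.toLp 2 (x.snd, -K x.fst) := rfl
    rw [h1, ← WithLp.toLp_sub]
    congr 1
    simp only [Prod.mk_sub_mk, sub_self, sub_apply]
    congr 1
    abel
  have h2 := norm_toLp_sq 0 (-((H - K) x.fst))
  rw [h, ← sq_eq_sq₀ (norm_nonneg _) (norm_nonneg _), h2, norm_neg, norm_zero]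
  ring

theorem isCompactOperator_diagOp {T : ℓ²(ℤ, ℂ) →L[ℂ] ℓ²(ℤ, ℂ)} (hT : IsCompactOperator T) :
    IsCompactOperator (diagOp T) := by
  let e := (WithLp.prodContinuousLinearEquiv 2 ℂ ℓ²(ℤ, ℂ) ℓ²(ℤ, ℂ)).symm.toContinuousLinearMap
  have h1 := ((hT.comp_clm (WithLp.fstL 2 ℂ ℓ²(ℤ, ℂ) ℓ²(ℤ, ℂ))).clm_comp
    (e ∘L ContinuousLinearMap.inl ℂ ℓ²(ℤ, ℂ) ℓ²(ℤ, ℂ)))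
  have h2 := ((hT.comp_clm (WithLp.sndL 2 ℂ ℓ²(ℤ, ℂ) ℓ²(ℤ, ℂ))).clm_comp
    (e ∘L ContinuousLinearMap.inr ℂ ℓ²(ℤ, ℂ) ℓ²(ℤ, ℂ)))
  have h3 : ⇑(diagOp T) =
      (e ∘L ContinuousLinearMap.inl ℂ ℓ²(ℤ, ℂ) ℓ²(ℤ, ℂ)) ∘
        T ∘ WithLp.fstL 2 ℂ ℓ²(ℤ, ℂ) ℓ²(ℤ, ℂ) +
      (e ∘L ContinuousLinearMap.inr ℂ ℓ²(ℤ, ℂ) ℓ²(ℤ, ℂ)) ∘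
        T ∘ WithLp.sndL 2 ℂ ℓ²(ℤ, ℂ) ℓ²(ℤ, ℂ) := by
    funext x
    change WithLp.toLp 2 (T x.fst, T x.snd) =
      WithLp.toLp 2 (T x.fst, 0) + WithLp.toLp 2 (0, T x.snd)
    rw [← WithLp.toLp_add]
    simp
  rw [h3]
  exact h1.add h2

end Blocks

/-! ### Weighted operators on the lattice -/

section Weights

theorem norm_permOp_le (σ : Equiv.Perm ℤ) : ‖permOp σ‖ ≤ 1 :=
  LinearMap.mkContinuous_norm_le _ zero_le_one _

theorem norm_grad_le (σ : Equiv.Perm ℤ) : ‖grad σ‖ ≤ 2 := by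
  refine (norm_sub_le _ _).trans ?_
  have h1 : ‖(1 : ℓ²(ℤ, ℂ) →L[ℂ] ℓ²(ℤ, ℂ))‖ ≤ 1 := ContinuousLinearMap.norm_id_le
  linarith [norm_permOp_le σ]

theorem adjoint_permOp (σ : Equiv.Perm ℤ) :
    ContinuousLinearMap.adjoint (permOp σ) = permOp σ.symm := by
  symm
  rw [ContinuousLinearMap.eq_adjoint_iff]
  intro x y
  rw [lp.inner_eq_tsum, lp.inner_eq_tsum, ← σ.tsum_eq]
  simp [permOp_apply]

theorem adjoint_grad (σ : Equiv.Perm ℤ) :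
    ContinuousLinearMap.adjoint (grad σ) = grad σ.symm := by
  rw [grad, map_sub, adjoint_permOp, grad, ← ContinuousLinearMap.star_eq_adjoint, star_one]

theorem chainOp_eq (σ : Equiv.Perm ℤ) (a b : ℓ^∞(ℤ, ℂ)) :
    chainOp σ a b = grad σ.symm * mulOp a * grad σ + mulOp b := by
  rw [chainOp, adjoint_grad]; rfl

theorem norm_chainOp_le (σ : Equiv.Perm ℤ) (a b : ℓ^∞(ℤ, ℂ)) :
    ‖chainOp σ a b‖ ≤ 2 * ‖mulOp a‖ * 2 + ‖mulOp b‖ := by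
  rw [chainOp_eq]
  refine (norm_add_le _ _).trans (add_le_add_left ?_ _)
  refine (norm_mul_le _ _).trans (mul_le_mul ((norm_mul_le _ _).trans ?_) (norm_grad_le _)
    (norm_nonneg _) (by positivity))
  gcongr
  exact norm_grad_le _

/-- The weight `1 / (1 + |j|)`. -/
noncomputable def weight : ℓ^∞(ℤ, ℂ) :=
  ⟨fun j => ((1 + |(j : ℝ)|)⁻¹ : ℝ), by
    refine memℓp_infty ⟨1, ?_⟩
    rintro _ ⟨j, rfl⟩
    simp only [Complex.norm_real, norm_inv]
    refine inv_le_one_of_one_le₀ ?_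
    rw [Real.norm_of_nonneg (by positivity)]
    linarith [abs_nonneg (j : ℝ)]⟩

theorem weight_apply (j : ℤ) : weight j = ((1 + |(j : ℝ)|)⁻¹ : ℝ) := rfl

theorem isCompactOperator_mulOp_single (j : ℤ) (a : ℂ) :
    IsCompactOperator (mulOp (lp.single ∞ j a)) := by
  have h : mulOp (lp.single ∞ j a) =
      (ContinuousLinearMap.toSpanSingleton ℂ (lp.single 2 j a : ℓ²(ℤ, ℂ))) ∘L
        lp.evalCLM ℂ (fun _ : ℤ => ℂ) 2 j := by
    ext v i
    have h1 : (mulOp (lp.single ∞ j a)) v i = (Pi.single j a : ℤ → ℂ) i * v i := rfl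
    have h2 : ((ContinuousLinearMap.toSpanSingleton ℂ (lp.single 2 j a : ℓ²(ℤ, ℂ))) ∘L
        lp.evalCLM ℂ (fun _ : ℤ => ℂ) 2 j) v i = v j * (Pi.single j a : ℤ → ℂ) i := rfl
    rw [h1, h2]
    by_cases hij : i = j
    · subst hij; exact mul_comm _ _
    · simp [Pi.single_eq_of_ne hij]
  rw [h]
  exact (isCompactOperator_of_locallyCompactSpace_rng (ContinuousLinearMap.toSpanSingleton ℂ
    (lp.single 2 j a : ℓ²(ℤ, ℂ)))).comp_clm _

/-- The weight vanishes at infinity, so truncating it to `[-k, k]` gives finite-rank operators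
converging in norm, with error at most `1 / (k + 1)`. -/
theorem isCompactOperator_mulOp_weight : IsCompactOperator (mulOp weight) := by
  have hlim : Filter.Tendsto (fun k : ℕ => ∑ j ∈ Finset.Icc (-k : ℤ) k, lp.single ∞ j (weight j))
      Filter.atTop (nhds weight) := by
    rw [tendsto_iff_norm_sub_tendsto_zero]
    refine squeeze_zero (fun _ => norm_nonneg _) (fun k => ?_)
      (tendsto_one_div_add_atTop_nhds_zero_nat (𝕜 := ℝ))
    refine lp.norm_le_of_forall_le (by positivity) fun i => ?_
    have h1 : (∑ j ∈ Finset.Icc (-k : ℤ) k, lp.single ∞ j (weight j) - weight) i =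
        (if i ∈ Finset.Icc (-k : ℤ) k then weight i else 0) - weight i := by
      rw [lp.coeFn_sub, Pi.sub_apply, lp.coeFn_sum, Finset.sum_apply]
      congr 1
      simp only [lp.single_apply]
      exact Finset.sum_pi_single _ _ _
    rw [h1]
    split_ifs with h
    · simp only [sub_self, norm_zero]; positivity
    · rw [zero_sub, norm_neg, weight_apply, Complex.norm_real, Real.norm_of_nonneg (by positivity),
        one_div]
      refine inv_anti₀ (by positivity) ?_
      have h2 : (k : ℤ) ≤ |i| := by
        rw [Finset.mem_Icc] at h
        by_contra hcon
        exact h (abs_le.mp (by omega))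
      have h3 : (k : ℝ) ≤ |(i : ℝ)| := by exact_mod_cast h2
      linarith
  refine isCompactOperator_of_tendsto ((mulOp.continuous.tendsto weight).comp hlim)
    (Filter.Eventually.of_forall fun k => ?_)
  simp only [Function.comp_apply, map_sum]
  induction (Finset.Icc (-k : ℤ) k) using Finset.induction_on with
  | empty => simpa using isCompactOperator_zero
  | insert j s hj ih =>
    rw [Finset.sum_insert hj]
    exact (isCompactOperator_mulOp_single j _).add ih

/-- Moving the weight through the shift costs the ratio `(1 + |j|) / (1 + |σ j|)`, at most `2` under
the hypothesis. The bound does not depend on `σ`. -/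
theorem exists_grad_mul_weight {σ : Equiv.Perm ℤ} (hσ : ∀ j, |j| ≤ |σ j| + 1) :
    ∃ G : ℓ²(ℤ, ℂ) →L[ℂ] ℓ²(ℤ, ℂ), grad σ * mulOp weight = mulOp weight * G ∧
      ‖G‖ ≤ 1 + ‖mulOp‖ * 2 := by
  have hb : ∀ j : ℤ, ‖((1 + |(j : ℝ)|) / (1 + |(σ j : ℝ)|) : ℝ)‖ ≤ 2 := fun j => by
    rw [Real.norm_of_nonneg (by positivity), div_le_iff₀ (by positivity)]
    have : |(j : ℝ)| ≤ |(σ j : ℝ)| + 1 := by exact_mod_cast hσ j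
    linarith [abs_nonneg (σ j : ℝ)]
  let q : ℓ^∞(ℤ, ℂ) := ⟨fun j => (((1 + |(j : ℝ)|) / (1 + |(σ j : ℝ)|) : ℝ) : ℂ), by
    refine memℓp_infty ⟨2, ?_⟩
    rintro _ ⟨j, rfl⟩
    simpa only [Complex.norm_real] using hb j⟩
  have hq : ‖q‖ ≤ 2 := lp.norm_le_of_forall_le (by norm_num) fun j => by
    have : q j = (((1 + |(j : ℝ)|) / (1 + |(σ j : ℝ)|) : ℝ) : ℂ) := rfl
    rw [this, Complex.norm_real]
    exact hb j
  refine ⟨1 - mulOp q * permOp σ, ?_, ?_⟩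
  · have : permOp σ * mulOp weight = mulOp weight * (mulOp q * permOp σ) := by
      ext v j
      change weight (σ j) * v (σ j) = weight j * (q j * v (σ j))
      rw [← mul_assoc]
      congr 1
      change (((1 + |(σ j : ℝ)|)⁻¹ : ℝ) : ℂ) = ((1 + |(j : ℝ)|)⁻¹ : ℝ) *
        (((1 + |(j : ℝ)|) / (1 + |(σ j : ℝ)|) : ℝ) : ℂ)
      rw [← Complex.ofReal_mul]
      congr 1
      have h1 : 1 + |(j : ℝ)| ≠ 0 := by positivity
      field_simp
    rw [grad, sub_mul, this, mul_sub, one_mul, mul_one]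
  · have h1 : ‖(1 : ℓ²(ℤ, ℂ) →L[ℂ] ℓ²(ℤ, ℂ))‖ ≤ 1 := ContinuousLinearMap.norm_id_le
    refine (norm_sub_le _ _).trans (add_le_add h1 ((norm_mul_le _ _).trans ?_))
    calc ‖mulOp q‖ * ‖permOp σ‖ ≤ (‖mulOp‖ * 2) * 1 := by
          gcongr
          · exact (mulOp.le_opNorm q).trans (by gcongr)
          · exact norm_permOp_le σ
      _ = ‖mulOp‖ * 2 := mul_one _

/-- Halving the decay rate pays for the factor `1 + |x|`: `(1 + |x|)²` is at most a multiple of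
`cosh (ρ x)`, and `cosh² (ρ x) ≤ cosh (2 ρ x)`. -/
theorem exists_mul_one_add_abs_le_sqrt_cosh {ρ : ℝ} (hρ : 0 < ρ) :
    ∃ D : ℝ, ∀ x : ℝ, √(Real.cosh (2 * (ρ / 2) * x)) * (1 + |x|) ≤
      D * √(Real.cosh (2 * ρ * x)) := by
  refine ⟨√(2 + 4 / ρ ^ 2), fun x => ?_⟩
  rw [← Real.sqrt_mul (by positivity)]
  have h1 : Real.cosh (2 * ρ * x) = 2 * Real.cosh (ρ * x) ^ 2 - 1 := by
    rw [mul_assoc, Real.cosh_two_mul]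
    linarith [Real.cosh_sq (ρ * x)]
  have h2 : 1 ≤ Real.cosh (ρ * x) := Real.one_le_cosh _
  have h3 : 1 + (ρ * x) ^ 2 / 2 ≤ Real.cosh (ρ * x) := by
    have h4 : (ρ * x / 2) ^ 2 ≤ Real.sinh (ρ * x / 2) ^ 2 := by
      rw [sq_le_sq, Real.abs_sinh]
      exact Real.self_le_sinh_iff.mpr (abs_nonneg _)
    have h5 : Real.cosh (ρ * x) = 1 + 2 * Real.sinh (ρ * x / 2) ^ 2 := by
      have := Real.cosh_two_mul (ρ * x / 2)
      rw [show 2 * (ρ * x / 2) = ρ * x by ring, Real.cosh_sq] at this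
      linarith
    rw [h5]
    nlinarith
  have h4 : 2 * (ρ / 2) * x = ρ * x := by ring
  rw [h4]
  refine Real.le_sqrt_of_sq_le ?_
  rw [mul_pow, Real.sq_sqrt (by positivity), h1]
  have h5 : (1 + |x|) ^ 2 ≤ 2 + 2 * x ^ 2 := by
    nlinarith [sq_abs x, sq_nonneg (1 - |x|)]
  have h6 : 2 + 2 * x ^ 2 ≤ (2 + 4 / ρ ^ 2) * (1 + (ρ * x) ^ 2 / 2) := by
    have h7 : (2 + 4 / ρ ^ 2) * (1 + (ρ * x) ^ 2 / 2) =
        2 + 2 * x ^ 2 + (4 / ρ ^ 2 + (ρ * x) ^ 2) := by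
      field_simp; ring
    rw [h7]
    have : 0 ≤ 4 / ρ ^ 2 + (ρ * x) ^ 2 := by positivity
    linarith
  have h8 : (0 : ℝ) ≤ 2 + 4 / ρ ^ 2 := by positivity
  calc Real.cosh (ρ * x) * (1 + |x|) ^ 2
      ≤ Real.cosh (ρ * x) * ((2 + 4 / ρ ^ 2) * Real.cosh (ρ * x)) := by
        gcongr
        exact (h5.trans h6).trans (by gcongr)
    _ = (2 + 4 / ρ ^ 2) * Real.cosh (ρ * x) ^ 2 := by ring
    _ ≤ _ := by
        gcongr
        nlinarith

/-- The decaying curve `(1 + |j|) w_j(t)`. -/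
noncomputable def DecayingCurve.weighted (w : DecayingCurve) : DecayingCurve where
  toFun j t := (1 + |(j : ℝ)|) * w.toFun j t
  continuous' j := continuous_const.mul (w.continuous' j)
  periodic' j t := congrArg _ (w.periodic' j t)
  decay' := by
    obtain ⟨ρ, hρ, C, hC⟩ := w.decay'
    obtain ⟨D, hD⟩ := exists_mul_one_add_abs_le_sqrt_cosh hρ
    have hD0 : 0 ≤ D := by
      have := hD 0
      simp at this
      linarith
    refine ⟨ρ / 2, by positivity, D * C, fun j t => ?_⟩
    rw [abs_mul, abs_of_nonneg (by positivity : 0 ≤ 1 + |(j : ℝ)|), ← mul_assoc]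
    calc _ ≤ D * √(Real.cosh (2 * ρ * j)) * |w.toFun j t| :=
          mul_le_mul_of_nonneg_right (hD j) (abs_nonneg _)
      _ = D * (√(Real.cosh (2 * ρ * j)) * |w.toFun j t|) := by ring
      _ ≤ D * C := by gcongr; exact hC j t

theorem mulOp_coeff (c : ℝ) (w : DecayingCurve) (t : ℝ) :
    mulOp (w.coeff c t) = (c : ℂ) • 1 + mulOp weight * mulOp (w.weighted.coeff 0 t) := by
  ext v j
  change ((c + w.toFun j t : ℝ) : ℂ) * v j = (c : ℂ) * v j + ((1 + |(j : ℝ)|)⁻¹ : ℝ) *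
    (((0 + (1 + |(j : ℝ)|) * w.toFun j t : ℝ) : ℂ) * v j)
  have h1 : 1 + |(j : ℝ)| ≠ 0 := by positivity
  rw [← mul_assoc, ← Complex.ofReal_mul, zero_add, inv_mul_cancel_left₀ h1, ← add_mul]
  push_cast
  rfl

theorem DecayingCurve.norm_coeff_le {w : DecayingCurve} {C : ℝ} (hC : ∀ j t, |w.toFun j t| ≤ C)
    (c t : ℝ) : ‖w.coeff c t‖ ≤ |c| + C := by
  have h0 : 0 ≤ C := (abs_nonneg _).trans (hC 0 0)
  refine lp.norm_le_of_forall_le (by positivity) fun j => ?_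
  rw [DecayingCurve.coeff_apply, Complex.norm_real, Real.norm_eq_abs]
  exact (abs_add_le _ _).trans (by gcongr; exact hC j t)

end Weights

/-! ### Convergence of the periodic chains -/

section Convergence

open Filter Topology

theorem tendsto_apply_zero_of_single {T : ℕ → ℓ²(ℤ, ℂ) →L[ℂ] ℓ²(ℤ, ℂ)} {C : ℝ}
    (hT : ∀ n, ‖T n‖ ≤ C)
    (h : ∀ (j : ℤ) (a : ℂ), Tendsto (fun n => T n (lp.single 2 j a)) atTop (𝓝 0))
    (v : ℓ²(ℤ, ℂ)) : Tendsto (fun n => T n v) atTop (𝓝 0) := by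
  have hC : 0 ≤ C := (norm_nonneg _).trans (hT 0)
  rw [Metric.tendsto_nhds]
  intro ε hε
  have hsum := lp.hasSum_single (p := 2) (by norm_num) v
  obtain ⟨s, hs⟩ := ((Metric.tendsto_nhds.mp hsum) (ε / (2 * (C + 1))) (by positivity)).exists
  have h1 : Tendsto (fun n => T n (∑ j ∈ s, lp.single 2 j (v j))) atTop (𝓝 0) := by
    simp only [map_sum]
    simpa using tendsto_finsetSum s fun j _ => h j (v j)
  filter_upwards [(Metric.tendsto_nhds.mp h1) (ε / 2) (by positivity)] with n hn
  rw [dist_zero_right] at hn ⊢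
  rw [dist_comm, dist_eq_norm] at hs
  have h2 : ‖T n (v - ∑ j ∈ s, lp.single 2 j (v j))‖ ≤ ε / 2 := by
    calc _ ≤ (C + 1) * (ε / (2 * (C + 1))) :=
          ((T n).le_of_opNorm_le ((hT n).trans (le_add_of_nonneg_right zero_le_one)) _).trans (by gcongr)
      _ = ε / 2 := by
          have : C + 1 ≠ 0 := by positivity
          field_simp
  calc ‖T n v‖ = ‖T n (v - ∑ j ∈ s, lp.single 2 j (v j)) + T n (∑ j ∈ s, lp.single 2 j (v j))‖ := by
        rw [← map_add, sub_add_cancel]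
    _ ≤ _ := norm_add_le _ _
    _ < ε := by linarith

/-- `permOp σ` moves the unit vector at `j` to `σ.symm j`, hence the inverse permutations in the
hypothesis. -/
theorem permOp_single_eq {σ τ : Equiv.Perm ℤ} {j : ℤ} (h : σ.symm j = τ.symm j) (a : ℂ) :
    permOp σ (lp.single 2 j a) = permOp τ (lp.single 2 j a) := by
  ext i
  rw [permOp_apply, permOp_apply, lp.single_apply, lp.single_apply]
  have hiff : σ i = j ↔ τ i = j := by
    rw [← Equiv.eq_symm_apply, ← Equiv.eq_symm_apply, h]
  by_cases hi : σ i = j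
  · rw [hi, hiff.mp hi]
  · rw [Pi.single_eq_of_ne hi, Pi.single_eq_of_ne (mt hiff.mpr hi)]

theorem grad_sub_grad (σ τ : Equiv.Perm ℤ) : grad σ - grad τ = permOp τ - permOp σ := by
  rw [grad, grad]; abel

theorem norm_grad_sub_grad_le (σ τ : Equiv.Perm ℤ) : ‖grad σ - grad τ‖ ≤ 2 := by
  rw [grad_sub_grad]
  refine (norm_sub_le _ _).trans ?_
  linarith [norm_permOp_le σ, norm_permOp_le τ]

theorem tendsto_grad_sub_grad {σ : ℕ → Equiv.Perm ℤ} {τ : Equiv.Perm ℤ}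
    (h : ∀ j, ∀ᶠ n in atTop, (σ n).symm j = τ.symm j) (v : ℓ²(ℤ, ℂ)) :
    Tendsto (fun n => (grad (σ n) - grad τ) v) atTop (𝓝 0) := by
  refine tendsto_apply_zero_of_single (fun n => norm_grad_sub_grad_le (σ n) τ) (fun j a => ?_) v
  refine tendsto_const_nhds.congr' ?_
  filter_upwards [h j] with n hn
  rw [grad_sub_grad, sub_apply, permOp_single_eq hn, sub_self]

theorem eventually_predRing_eq (j : ℤ) : ∀ᶠ n : ℕ in atTop, predRing n j = pred j := by
  filter_upwards [eventually_gt_atTop (j.natAbs + 1)] with n hn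
  change (if -(n : ℤ) < j ∧ j ≤ n then (if j = 1 - n then (n : ℤ) else j - 1) else j) = j - 1
  rw [if_pos (by omega), if_neg (by omega)]

theorem eventually_predRing_symm_eq (j : ℤ) :
    ∀ᶠ n : ℕ in atTop, (predRing n).symm j = pred.symm j := by
  filter_upwards [eventually_gt_atTop (j.natAbs + 1)] with n hn
  change (if -(n : ℤ) < j ∧ j ≤ n then (if j = n then 1 - (n : ℤ) else j + 1) else j) = j + 1
  rw [if_pos (by omega), if_neg (by omega)]

theorem abs_le_abs_pred_add_one (j : ℤ) : |j| ≤ |pred j| + 1 := by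
  change |j| ≤ |j - 1| + 1
  grind

theorem abs_le_abs_pred_symm_add_one (j : ℤ) : |j| ≤ |pred.symm j| + 1 := by
  change |j| ≤ |j + 1| + 1
  grind

theorem abs_le_abs_predRing_add_one (n : ℕ) (j : ℤ) : |j| ≤ |predRing n j| + 1 := by
  change |j| ≤ |if -(n : ℤ) < j ∧ j ≤ n then (if j = 1 - n then (n : ℤ) else j - 1) else j| + 1
  grind

theorem abs_le_abs_predRing_symm_add_one (n : ℕ) (j : ℤ) : |j| ≤ |(predRing n).symm j| + 1 := by
  change |j| ≤ |if -(n : ℤ) < j ∧ j ≤ n then (if j = n then 1 - (n : ℤ) else j + 1) else j| + 1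
  grind

theorem eventually_norm_grad_mul_grad_sub_le {a : ℝ → ℓ²(ℤ, ℂ) →L[ℂ] ℓ²(ℤ, ℂ)}
    (ha : Continuous a) {c : ℝ → ℓ²(ℤ, ℂ)} (hc : Continuous c) (T : ℝ) {ε : ℝ} (hε : 0 < ε) :
    ∀ᶠ n : ℕ in atTop, ∀ t ∈ Set.Icc 0 T, ‖(grad (predRing n).symm * a t * grad (predRing n) -
      grad pred.symm * a t * grad pred) (c t)‖ ≤ ε := by
  obtain ⟨D, hD⟩ := (isCompact_Icc (a := 0) (b := T)).exists_bound_of_continuousOn ha.continuousOn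
  have h1 := eventually_forall_norm_le_of_isCompact
    (fun n => norm_grad_sub_grad_le (predRing n) pred)
    (tendsto_grad_sub_grad eventually_predRing_symm_eq)
    ((isCompact_Icc (a := 0) (b := T)).image hc) (show 0 < ε / (4 * (|D| + 1)) by positivity)
  have hc2 : Continuous fun t => a t (grad pred (c t)) :=
    ha.clm_apply ((grad pred).continuous.comp hc)
  have h2 := eventually_forall_norm_le_of_isCompact
    (fun n => norm_grad_sub_grad_le (predRing n).symm pred.symm)
    (tendsto_grad_sub_grad fun j => by simpa using eventually_predRing_eq j)
    ((isCompact_Icc (a := 0) (b := T)).image hc2) (show 0 < ε / 2 by positivity)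
  filter_upwards [h1, h2] with n hn1 hn2 t ht
  have e1 := hn1 _ ⟨t, ht, rfl⟩
  have e2 := hn2 _ ⟨t, ht, rfl⟩
  -- In each summand the difference of gradients acts on a curve independent of `n`, so compactness
  -- of that curve on `[0, T]` gives uniformity in `t`.
  have hsplit : (grad (predRing n).symm * a t * grad (predRing n) -
      grad pred.symm * a t * grad pred) (c t) =
      grad (predRing n).symm (a t ((grad (predRing n) - grad pred) (c t))) +
        (grad (predRing n).symm - grad pred.symm) (a t (grad pred (c t))) := by
    simp only [sub_apply, mul_apply_eq_comp, map_sub]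
    abel
  rw [hsplit]
  refine (norm_add_le _ _).trans ?_
  have e3 : ‖grad (predRing n).symm (a t ((grad (predRing n) - grad pred) (c t)))‖ ≤ ε / 2 := by
    calc _ ≤ 2 * ((|D| + 1) * (ε / (4 * (|D| + 1)))) := by
          refine ((grad (predRing n).symm).le_of_opNorm_le (norm_grad_le _) _).trans ?_
          gcongr
          refine ((a t).le_of_opNorm_le ((hD t ht).trans ?_) _).trans (by gcongr)
          linarith [le_abs_self D]
      _ = ε / 2 := by
          have : |D| + 1 ≠ 0 := by positivity
          field_simp; norm_num
  linarith

theorem eventually_norm_coeff_truncate_sub_le (w : DecayingCurve) (c : ℝ) {ε : ℝ} (hε : 0 < ε) :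
    ∀ᶠ n : ℕ in atTop, ∀ t, ‖(w.truncate n).coeff c t - w.coeff c t‖ ≤ ε := by
  obtain ⟨C, hC⟩ := w.weighted.exists_bound
  have hlim : Tendsto (fun n : ℕ => C * (1 / ((n : ℝ) + 1))) atTop (𝓝 0) := by
    simpa using (tendsto_one_div_add_atTop_nhds_zero_nat (𝕜 := ℝ)).const_mul C
  filter_upwards [hlim.eventually_le_const hε] with n hn t
  refine lp.norm_le_of_forall_le hε.le fun j => ?_
  have hC' : (1 + |(j : ℝ)|) * |w.toFun j t| ≤ C := by
    have := hC j t
    change |(1 + |(j : ℝ)|) * w.toFun j t| ≤ C at this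
    rwa [abs_mul, abs_of_nonneg (by positivity : 0 ≤ 1 + |(j : ℝ)|)] at this
  rw [lp.coeFn_sub, Pi.sub_apply, DecayingCurve.coeff_apply, DecayingCurve.coeff_apply,
    ← Complex.ofReal_sub, Complex.norm_real, Real.norm_eq_abs, add_sub_add_left_eq_sub]
  change |(if -(n : ℤ) < j ∧ j ≤ n then w.toFun j t else 0) - w.toFun j t| ≤ ε
  split_ifs with h
  · simpa using hε.le
  · rw [zero_sub, abs_neg]
    refine le_trans ?_ hn
    rw [mul_one_div, le_div_iff₀ (by positivity)]
    -- Equality occurs at `j = -n`, the omitted left end of `ℤ_n`.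
    have h2 : (n : ℤ) ≤ |j| := by
      by_contra hcon
      exact h ⟨by grind, by grind⟩
    have h3 : (n : ℝ) ≤ |(j : ℝ)| := by exact_mod_cast h2
    nlinarith [abs_nonneg (w.toFun j t)]

theorem eventually_norm_ringH_sub_chainH_le (αbar βbar : ℝ) (α' β' : DecayingCurve)
    {c : ℝ → ℓ²(ℤ, ℂ)} (hc : Continuous c) (T : ℝ) {ε : ℝ} (hε : 0 < ε) :
    ∀ᶠ n : ℕ in atTop, ∀ t ∈ Set.Icc 0 T,
      ‖(ringH αbar βbar α' β' n t - chainH αbar βbar α' β' t) (c t)‖ ≤ ε := by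
  obtain ⟨D, hD⟩ := (isCompact_Icc (a := 0) (b := T)).exists_bound_of_continuousOn hc.continuousOn
  have h1 := eventually_norm_grad_mul_grad_sub_le
    (mulOp.continuous.comp (α'.continuous_coeff αbar)) hc T (half_pos hε)
  have h2 := eventually_norm_coeff_truncate_sub_le β' βbar
    (show 0 < ε / (2 * ((‖mulOp‖ + 1) * (|D| + 1))) by positivity)
  filter_upwards [h1, h2] with n hn1 hn2 t ht
  have hsplit : (ringH αbar βbar α' β' n t - chainH αbar βbar α' β' t) (c t) =
      (grad (predRing n).symm * mulOp (α'.coeff αbar t) * grad (predRing n) -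
        grad pred.symm * mulOp (α'.coeff αbar t) * grad pred) (c t) +
      mulOp ((β'.truncate n).coeff βbar t - β'.coeff βbar t) (c t) := by
    rw [ringH, chainH, chainOp_eq, chainOp_eq, map_sub]
    simp only [sub_apply, add_apply]
    abel
  rw [hsplit]
  refine (norm_add_le _ _).trans ?_
  have e2 : ‖mulOp ((β'.truncate n).coeff βbar t - β'.coeff βbar t) (c t)‖ ≤ ε / 2 := by
    calc _ ≤ ((‖mulOp‖ + 1) * (ε / (2 * ((‖mulOp‖ + 1) * (|D| + 1))))) * (|D| + 1) := by
          refine (ContinuousLinearMap.le_opNorm _ _).trans ?_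
          gcongr
          · refine (mulOp.le_opNorm _).trans ?_
            gcongr
            · linarith
            · exact hn2 t
          · exact (hD t ht).trans (by linarith [le_abs_self D])
      _ = ε / 2 := by
          have h3 : |D| + 1 ≠ 0 := by positivity
          have h4 : ‖mulOp‖ + 1 ≠ 0 := by positivity
          field_simp
  exact (add_le_add (hn1 t ht) e2).trans_eq (add_halves ε)

end Convergence

/-! ### The flows as compact perturbations of the free flows -/

section Decomposition

/-- The operator `ᾱ ∇*∇ + β̄`. -/
noncomputable def freeH (αbar βbar : ℝ) (σ : Equiv.Perm ℤ) : ℓ²(ℤ, ℂ) →L[ℂ] ℓ²(ℤ, ℂ) :=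
  (αbar : ℂ) • (grad σ.symm * grad σ) + (βbar : ℂ) • 1

theorem freeH_eq (αbar βbar : ℝ) (σ : Equiv.Perm ℤ) : freeH αbar βbar σ =
    grad σ.symm * ((αbar : ℂ) • 1) * grad σ + (βbar : ℂ) • 1 := by
  rw [freeH, mul_smul_comm, mul_one, smul_mul_assoc]

theorem norm_smul_one_le (a : ℝ) : ‖(a : ℂ) • (1 : ℓ²(ℤ, ℂ) →L[ℂ] ℓ²(ℤ, ℂ))‖ ≤ |a| := by
  have h1 : ‖(1 : ℓ²(ℤ, ℂ) →L[ℂ] ℓ²(ℤ, ℂ))‖ ≤ 1 := ContinuousLinearMap.norm_id_le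
  rw [norm_smul, Complex.norm_real, Real.norm_eq_abs]
  exact mul_le_of_le_one_right (abs_nonneg a) h1

theorem norm_freeH_le (αbar βbar : ℝ) (σ : Equiv.Perm ℤ) :
    ‖freeH αbar βbar σ‖ ≤ 2 * |αbar| * 2 + |βbar| := by
  rw [freeH_eq]
  refine (norm_add_le _ _).trans (add_le_add ?_ (norm_smul_one_le βbar))
  refine (norm_mul_le _ _).trans (mul_le_mul ((norm_mul_le _ _).trans
    (mul_le_mul (norm_grad_le _) (norm_smul_one_le αbar) (norm_nonneg _) (by norm_num)))
    (norm_grad_le _) (norm_nonneg _) (by positivity))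

theorem vectorField_freeH_mul_self (αbar βbar : ℝ) (σ : Equiv.Perm ℤ) :
    vectorField (freeH αbar βbar σ) * vectorField (freeH αbar βbar σ) =
      -((αbar : ℂ) • (star (diagOp (grad σ)) * diagOp (grad σ)) + (βbar : ℂ) • 1) := by
  rw [vectorField_mul_self, star_diagOp, ContinuousLinearMap.star_eq_adjoint, adjoint_grad]
  exact phase_clm_ext fun _ _ => rfl

/-- The free flow over one period. -/
noncomputable def freeFlow (αbar βbar : ℝ) (σ : Equiv.Perm ℤ) : Phase →L[ℂ] Phase :=
  timeMap (fun _ => vectorField (freeH αbar βbar σ)) continuous_const (2 * Real.pi)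

theorem continuous_generator (αbar βbar : ℝ) (α' β' : DecayingCurve) (σ : Equiv.Perm ℤ) :
    Continuous fun t => vectorField (chainOp σ (α'.coeff αbar t) (β'.coeff βbar t)) :=
  continuous_vectorField.comp (continuous_chainOp σ
    (α'.continuous_coeff αbar) (β'.continuous_coeff βbar))

theorem norm_mulOp_coeff_le {w : DecayingCurve} {C : ℝ} (hC : ∀ j t, |w.toFun j t| ≤ C)
    (c t : ℝ) : ‖mulOp (w.coeff c t)‖ ≤ ‖mulOp‖ * (|c| + C) :=
  (mulOp.le_opNorm _).trans (by gcongr; exact DecayingCurve.norm_coeff_le hC c t)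

theorem DecayingCurve.abs_le_of_weighted {w : DecayingCurve} {C : ℝ}
    (hC : ∀ j t, |w.weighted.toFun j t| ≤ C) (j : ℤ) (t : ℝ) : |w.toFun j t| ≤ C := by
  refine le_trans ?_ (hC j t)
  change _ ≤ |(1 + |(j : ℝ)|) * w.toFun j t|
  rw [abs_mul, abs_of_nonneg (by positivity : 0 ≤ 1 + |(j : ℝ)|)]
  nlinarith [abs_nonneg (j : ℝ), abs_nonneg (w.toFun j t),
    mul_nonneg (abs_nonneg (j : ℝ)) (abs_nonneg (w.toFun j t))]

theorem DecayingCurve.abs_weighted_truncate_le {w : DecayingCurve} {C : ℝ}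
    (hC : ∀ j t, |w.weighted.toFun j t| ≤ C) (n : ℕ) (j : ℤ) (t : ℝ) :
    |(w.truncate n).weighted.toFun j t| ≤ C := by
  refine le_trans ?_ (hC j t)
  change |(1 + |(j : ℝ)|) * (if -(n : ℤ) < j ∧ j ≤ n then w.toFun j t else 0)| ≤
    |(1 + |(j : ℝ)|) * w.toFun j t|
  split_ifs
  · rfl
  · rw [mul_zero, abs_zero]
    exact abs_nonneg _

theorem norm_generator_le {αbar βbar Ca Cb : ℝ} {α' β' : DecayingCurve}
    (ha : ∀ j t, |α'.weighted.toFun j t| ≤ Ca) (hb : ∀ j t, |β'.weighted.toFun j t| ≤ Cb)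
    (σ : Equiv.Perm ℤ) (t : ℝ) :
    ‖vectorField (chainOp σ (α'.coeff αbar t) (β'.coeff βbar t))‖ ≤
      1 + (2 * (‖mulOp‖ * (|αbar| + Ca)) * 2 + ‖mulOp‖ * (|βbar| + Cb)) := by
  refine (norm_vectorField_le _).trans ?_
  gcongr
  refine (norm_chainOp_le _ _ _).trans ?_
  gcongr
  · exact norm_mulOp_coeff_le (DecayingCurve.abs_le_of_weighted ha) αbar t
  · exact norm_mulOp_coeff_le (DecayingCurve.abs_le_of_weighted hb) βbar t

/-- The constant is chosen before `σ` and the curves, so a single bound serves the line and all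
rings; this is the collective compactness. -/
theorem exists_timeMap_generator_eq (αbar βbar Ca Cb : ℝ) : ∃ C : ℝ, ∀ (σ : Equiv.Perm ℤ)
    (_ : ∀ j, |j| ≤ |σ j| + 1) (_ : ∀ j, |j| ≤ |σ.symm j| + 1) (α' β' : DecayingCurve)
    (_ : ∀ j t, |α'.weighted.toFun j t| ≤ Ca) (_ : ∀ j t, |β'.weighted.toFun j t| ≤ Cb),
    ∃ Z : Phase →L[ℂ] Phase,
      timeMap _ (continuous_generator αbar βbar α' β' σ) (2 * Real.pi) =
        freeFlow αbar βbar σ + diagOp (mulOp weight) * Z ∧ ‖Z‖ ≤ C := by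
  set g : ℝ := 1 + ‖mulOp‖ * 2 with hg
  set c₁ : ℝ := 1 + (g * |αbar| * g + |βbar|)
  -- `c₁` bounds the intertwined free generator, `c₂` the perturbation with its weight removed (the
  -- last `1` is for `vectorField 0`), and `c₃` the full generator.
  set c₂ : ℝ := (1 + (g * (‖mulOp‖ * (|0| + Ca)) * 2 + ‖mulOp‖ * (|0| + Cb))) + 1
  set c₃ : ℝ := 1 + (2 * (‖mulOp‖ * (|αbar| + Ca)) * 2 + ‖mulOp‖ * (|βbar| + Cb))
  refine ⟨Real.exp (c₁ * (2 * Real.pi)) * (c₂ * Real.exp (c₃ * (2 * Real.pi))) * (2 * Real.pi),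
    fun σ hσ hσ' α' β' ha hb => ?_⟩
  have hg0 : 0 ≤ g := by positivity
  obtain ⟨G, hG, hGn⟩ := exists_grad_mul_weight hσ
  obtain ⟨G', hG', hGn'⟩ := exists_grad_mul_weight hσ'
  set M := mulOp weight with hM
  have hH : freeH αbar βbar σ * M = M * (G' * ((αbar : ℂ) • 1) * G + (βbar : ℂ) • 1) := by
    have h1 : grad σ.symm * ((αbar : ℂ) • 1) * grad σ * M = M * (G' * ((αbar : ℂ) • 1) * G) := by
      simp only [mul_smul_comm, smul_mul_assoc, mul_one]
      rw [mul_assoc, hG, ← mul_assoc, hG', mul_assoc]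
    have h2 : ((βbar : ℂ) • 1) * M = M * ((βbar : ℂ) • 1) := by
      rw [smul_mul_assoc, mul_smul_comm, one_mul, mul_one]
    rw [freeH_eq, add_mul, mul_add, h1, h2]
  set W : ℝ → ℓ²(ℤ, ℂ) →L[ℂ] ℓ²(ℤ, ℂ) := fun t =>
    G' * mulOp (α'.weighted.coeff 0 t) * grad σ + mulOp (β'.weighted.coeff 0 t) with hW
  have hWc : Continuous W := by
    have h1 := mulOp.continuous.comp (α'.weighted.continuous_coeff 0)
    have h2 := mulOp.continuous.comp (β'.weighted.continuous_coeff 0)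
    exact ((continuous_const.mul h1).mul continuous_const).add h2
  have hchain : ∀ t, chainOp σ (α'.coeff αbar t) (β'.coeff βbar t) =
      freeH αbar βbar σ + M * W t := fun t => by
    have h1 : grad σ.symm * (M * mulOp (α'.weighted.coeff 0 t)) * grad σ =
        M * (G' * mulOp (α'.weighted.coeff 0 t) * grad σ) := by
      rw [← mul_assoc, hG']
      simp only [mul_assoc]
    rw [chainOp_eq, mulOp_coeff αbar, mulOp_coeff βbar, freeH_eq, mul_add, add_mul, mul_add, ← hM,
      h1]
    abel
  have hWn : ∀ t, ‖W t‖ ≤ g * (‖mulOp‖ * (|0| + Ca)) * 2 + ‖mulOp‖ * (|0| + Cb) := fun t => by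
    refine (norm_add_le _ _).trans (add_le_add ?_ (norm_mulOp_coeff_le hb 0 t))
    have h1 := norm_mulOp_coeff_le ha 0 t
    have h0 := (norm_nonneg _).trans h1
    refine (norm_mul_le _ _).trans (mul_le_mul ((norm_mul_le _ _).trans
      (mul_le_mul hGn' h1 (norm_nonneg _) hg0)) (norm_grad_le σ) (norm_nonneg _) (by positivity))
  refine exists_timeMap_eq_add_mul (continuous_generator αbar βbar α' β' σ)
    (X' := vectorField (G' * ((αbar : ℂ) • 1) * G + (βbar : ℂ) • 1))
    (W := fun t => vectorField (W t) - vectorField 0)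
    ((continuous_vectorField.comp hWc).sub continuous_const) (vectorField_mul_diagOp hH)
    (fun t => by rw [hchain t, vectorField_add_mul]) (by positivity) ?_ (fun t => ?_)
    (norm_generator_le ha hb σ)
  · refine (norm_vectorField_le _).trans ?_
    refine add_le_add_right ((norm_add_le _ _).trans (add_le_add ?_ (norm_smul_one_le βbar))) _
    exact (norm_mul_le _ _).trans (mul_le_mul ((norm_mul_le _ _).trans
      (mul_le_mul hGn' (norm_smul_one_le αbar) (norm_nonneg _) hg0)) hGn (norm_nonneg _)
      (by positivity))
  · refine (norm_sub_le _ _).trans (add_le_add ((norm_vectorField_le _).trans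
      (add_le_add_right (hWn t) _)) ((norm_vectorField_le _).trans ?_))
    simp

end Decomposition

/-! ### Strong convergence of the flows, uniform free resolvent bounds, and the theorem -/

section Main

open Filter Topology

theorem tendsto_ringFlow_apply (αbar βbar : ℝ) (α' β' : DecayingCurve) (x : Phase) :
    Tendsto (fun n => ringFlow αbar βbar α' β' n (2 * Real.pi) x) atTop
      (𝓝 (chainFlow αbar βbar α' β' (2 * Real.pi) x)) := by
  obtain ⟨Ca, ha⟩ := α'.weighted.exists_bound
  obtain ⟨Cb, hb⟩ := β'.weighted.exists_bound
  refine tendsto_timeMap_apply (fun n => continuous_generator αbar βbar α' (β'.truncate n)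
    (predRing n)) (continuous_generator αbar βbar α' β' pred) (by positivity)
    (fun n t => norm_generator_le ha (DecayingCurve.abs_weighted_truncate_le hb n)
      (predRing n) t) x fun ε hε => ?_
  have hc : Continuous fun t => (timeMap _ (continuous_generator αbar βbar α' β' pred) t x).fst :=
    (WithLp.fstL 2 ℂ ℓ²(ℤ, ℂ) ℓ²(ℤ, ℂ)).continuous.comp
      ((continuous_timeMap _ _).clm_apply continuous_const)
  filter_upwards [eventually_norm_ringH_sub_chainH_le αbar βbar α' β' hc (2 * Real.pi) hε]
    with n hn t ht
  rw [vectorField_sub_toLp]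
  exact hn t ht

theorem tendsto_freeFlow_apply (αbar βbar : ℝ) (x : Phase) :
    Tendsto (fun n => freeFlow αbar βbar (predRing n) x) atTop (𝓝 (freeFlow αbar βbar pred x)) := by
  have hbound : ∀ n (_ : ℝ), ‖vectorField (freeH αbar βbar (predRing n))‖ ≤
      1 + (2 * |αbar| * 2 + |βbar|) := fun n _ =>
    (norm_vectorField_le _).trans (add_le_add_right (norm_freeH_le αbar βbar (predRing n)) 1)
  have hc : Continuous fun t => (timeMap (fun _ => vectorField (freeH αbar βbar pred))
      continuous_const t x).fst :=
    (WithLp.fstL 2 ℂ ℓ²(ℤ, ℂ) ℓ²(ℤ, ℂ)).continuous.comp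
      ((continuous_timeMap _ _).clm_apply continuous_const)
  refine tendsto_timeMap_apply (An := fun n _ => vectorField (freeH αbar βbar (predRing n)))
    (A := fun _ => vectorField (freeH αbar βbar pred)) (T := 2 * Real.pi)
    (fun _ => continuous_const) continuous_const (by positivity) hbound x ?_
  intro ε hε
  filter_upwards [eventually_norm_grad_mul_grad_sub_le (a := fun _ => (αbar : ℂ) • 1)
    continuous_const hc (2 * Real.pi) hε] with n hn t ht
  rw [vectorField_sub_toLp]
  have hdiff : freeH αbar βbar (predRing n) - freeH αbar βbar pred =
      grad (predRing n).symm * ((αbar : ℂ) • 1) * grad (predRing n) -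
        grad pred.symm * ((αbar : ℂ) • 1) * grad pred := by
    rw [freeH_eq, freeH_eq, add_sub_add_right_eq_sub]
  rw [hdiff]
  exact hn t ht

instance : Nontrivial Phase :=
  ⟨0, WithLp.toLp 2 (lp.single 2 0 1, 0), fun h => by
    have h1 := congrArg (fun x : Phase => x.fst 0) h
    have h2 : (0 : ℂ) = (Pi.single 0 1 : ℤ → ℂ) 0 := h1
    simp at h2⟩

theorem exists_free_resolvent_bound {αbar βbar : ℝ} {z : ℂ} (hz : z ∉ essSpec αbar βbar) :
    ∃ c : ℝ, 0 < c ∧ ∀ σ : Equiv.Perm ℤ,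
      IsUnit (algebraMap ℂ (Phase →L[ℂ] Phase) z - freeFlow αbar βbar σ) ∧
      ∀ x, c * ‖x‖ ≤ ‖z • x - freeFlow αbar βbar σ x‖ := by
  obtain ⟨δ, hδ, hball⟩ := Metric.isOpen_iff.mp (isClosed_essSpec αbar βbar).isOpen_compl z hz
  have hδz : ∀ w ∈ essSpec αbar βbar, δ ≤ ‖z - w‖ := fun w hw => by
    by_contra hcon
    have hwb : w ∈ Metric.ball z δ := by
      rw [Metric.mem_ball, dist_comm, dist_eq_norm]
      exact not_le.mp hcon
    exact hball hwb hw
  refine ⟨δ ^ 2 / (‖z‖ + Real.exp ((1 + (2 * |αbar| * 2 + |βbar|)) * (2 * Real.pi))),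
    by positivity, fun σ => ?_⟩
  obtain ⟨h1, h2⟩ := exists_resolvent_bound_of_mul_self_eq hδ hδz
    ((norm_diagOp_le _).trans (norm_grad_le σ)) (vectorField_freeH_mul_self αbar βbar σ)
  exact ⟨h1, h2 _ ((norm_vectorField_le _).trans (add_le_add_right
      (norm_freeH_le αbar βbar σ) 1))⟩

end Main

end LatticeFlow

theorem theorem2p13 (αbar βbar : ℝ) (α' β' : LatticeFlow.DecayingCurve) (μ : ℂ)
    (hμ : μ ∉ LatticeFlow.essSpec αbar βbar) :
    Module.End.HasEigenvalue
        (LatticeFlow.chainFlow αbar βbar α' β' (2 * Real.pi) :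
          LatticeFlow.Phase →ₗ[ℂ] LatticeFlow.Phase) μ ↔
      ∃ l : ℕ → ℂ,
        (∀ n, 1 ≤ n →
          l n ∈ spectrum ℂ (LatticeFlow.ringFlow αbar βbar α' β' n (2 * Real.pi))) ∧
        MapClusterPt μ Filter.atTop l := by
  open LatticeFlow in
  obtain ⟨Ca, ha⟩ := α'.weighted.exists_bound
  obtain ⟨Cb, hb⟩ := β'.weighted.exists_bound
  obtain ⟨C, hC⟩ := exists_timeMap_generator_eq αbar βbar Ca Cb
  obtain ⟨Z, hZ, -⟩ := hC pred abs_le_abs_pred_add_one abs_le_abs_pred_symm_add_one α' β' ha hb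
  -- Truncating `β'` does not increase its weighted bound, so `Ca`, `Cb` and hence `C` serve every
  -- `n`.
  choose Zn hZn hZnC using fun n : ℕ => hC (predRing n) (abs_le_abs_predRing_add_one n)
    (abs_le_abs_predRing_symm_add_one n) α' (β'.truncate n) ha
    (DecayingCurve.abs_weighted_truncate_le hb n)
  have hspec : ∀ σ : Equiv.Perm ℤ,
      spectrum ℂ (freeFlow αbar βbar σ) ⊆ essSpec αbar βbar := by
    intro σ z hz
    by_contra hzS
    obtain ⟨c, -, h⟩ := exists_free_resolvent_bound hzS
    exact spectrum.notMem_iff.mpr (h σ).1 hz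
  refine hasEigenvalue_iff_mapClusterPt (isClosed_essSpec αbar βbar)
    (fun z hz => norm_eq_one_or_im_eq_zero_of_mem_essSpec hz)
    (isCompactOperator_diagOp isCompactOperator_mulOp_weight) hZ hZn hZnC
    (fun n => norm_timeMap_le _ (T := 2 * Real.pi) (fun t _ => norm_generator_le ha
      (DecayingCurve.abs_weighted_truncate_le hb n) (predRing n) t) ⟨by positivity, le_rfl⟩)
    (tendsto_freeFlow_apply αbar βbar) (tendsto_ringFlow_apply αbar βbar α' β') (hspec pred)
    (fun n => hspec (predRing n)) (fun z hz => ?_) (isUnit_timeMap _ _ _) hμ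
  obtain ⟨c, hc, h⟩ := exists_free_resolvent_bound hz
  exact ⟨c, hc, fun n x => (h (predRing n)).2 x⟩
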